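/- Consider five points $(\cos\theta_i,\sin\theta_i)$, $i=1,\dots,5$, on the unit circle, with masses $m_1,\dots,m_5>0$. Write $r_{i,j}=2\left|\sin\frac{\theta_i-\theta_j}{2}\right|$ for their mutual distances and $$f_{i,j}=\sin(\theta_i-\theta_j)\left(\frac{1}{r_{i,j}^{3}}-1\right)\ (i\ne j),\qquad f_{i,i}=0 .$$ The points form a (Newtonian) $1+5$ coorbital central configuration for the masses if they are pairwise distinct and $\sum_{j} f_{i,j}\,m_j=0$ for $i=1,\dots,5$; equivalently, $\theta$ is a critical point of $$V(\theta)=\sum_{i<j} m_i m_j\left(\frac{1}{r_{i,j}}+\frac{r_{i,j}^2}{2}\right).$$ Call the configuration convex and symmetric if $\theta_1>\theta_2>\theta_3>\theta_4>\theta_5$, $\theta_1-\theta_5\le\pi$ and $\theta_1+\theta_5=\theta_2+\theta_4=2\theta_3$. **Theorem 5.** For each positive mass vector $(m_1,\dots,m_5)$ there is, up to rotation, at most one convex symmetric central configuration. Moreover, if $m_1=m_5$ and $m_2=m_4$, then every convex symmetric central configuration $\theta$ is a local minimum of $V$, nondegenerate up to rotation: for the Hessian $H$ of $V$ at $\theta$,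 $v^{T}Hv>0$ for every $v\in\mathbb{R}^5$ that is not a multiple of $(1,1,1,1,1)$. -/

import Mathlib

namespace Coorbital

/-- The distance between two points of the unit circle whose polar angles differ by `x`. -/
noncomputable def mutualDist (x : ℝ) : ℝ := 2 * |Real.sin (x / 2)|

/-- The Newtonian interaction function `f(x) = sin x (1 / r^3 - 1)`, `r` being the distance
between two points of the unit circle at angular difference `x`. -/
noncomputable def force (x : ℝ) : ℝ := Real.sin x * (1 / mutualDist x ^ 3 - 1)

/-- The mass coefficient matrix `F` of `N` points of the unit circle with polar angles `θ`:
`F i j = f(θ i - θ j)`; its diagonal vanishes because `sin 0 = 0`. -/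
noncomputable def massMatrix {N : ℕ} (θ : Fin N → ℝ) : Matrix (Fin N) (Fin N) ℝ :=
  Matrix.of fun i j => force (θ i - θ j)

/-- The effective (Hall) potential `V = ∑_{i < j} m i m j (1 / r i j + (r i j)^2 / 2)`, as a
function of the polar angles. -/
noncomputable def potential {N : ℕ} (m θ : Fin N → ℝ) : ℝ :=
  ∑ i, ∑ j ∈ Finset.Ioi i,
    m i * m j * (1 / mutualDist (θ i - θ j) + mutualDist (θ i - θ j) ^ 2 / 2)

/-- `θ` is a coorbital (`1+N`) central configuration for the masses `m`: the points of the unit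
circle with polar angles `θ` are pairwise distinct, and `F m = 0`. -/
def IsCentralConfiguration {N : ℕ} (m θ : Fin N → ℝ) : Prop :=
  (∀ i j, i ≠ j → mutualDist (θ i - θ j) ≠ 0) ∧ Matrix.mulVec (massMatrix θ) m = 0

/-- Five points on the circle, listed by decreasing polar angle, form a convex symmetric
configuration: they lie on a closed half circle, and the reflection in the axis through the
centre and the middle point maps the configuration to itself, exchanging the first and the last
and the second and the fourth point. -/
structure IsConvexSymmetric (θ : Fin 5 → ℝ) : Prop where
  ordered : StrictAnti θ
  convex : θ 0 - θ 4 ≤ Real.pi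
  symmetric : ∀ i, θ i + θ i.rev = 2 * θ 2

/-- `θ` is a local minimum of the potential, nondegenerate up to rotations: the Hessian quadratic
form of the potential at `θ` (that is, the second derivative along the line through `θ` in the
direction `v`) is positive for every `v` that does not generate a rotation. -/
def IsNondegenerateMin {N : ℕ} (m θ : Fin N → ℝ) : Prop :=
  IsLocalMin (potential m) θ ∧
    ∀ v : Fin N → ℝ, (¬ ∃ c : ℝ, ∀ i, v i = c) →
      0 < iteratedDeriv 2 (fun t : ℝ => potential m (θ + t • v)) 0

end Coorbital

namespace Coorbital
open Real Filter Topology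

/-! Rotate a convex symmetric configuration to the angles b, a, 0, -a, -b with 0 < a < b ≤ π/2.
Since f is odd, subtracting the equations of mirror points leaves two equations in (a, b), with
averaged outer and inner masses p, q and middle mass s. Uniqueness therefore only needs symmetric
masses.

Fix b. Division by cos a makes the inner force strictly monotone in a
(`innerForce_div_cos_strictMonoOn`), and it runs from -∞ to ∞, so it has exactly one root,
continuous in b. Along this curve of roots the outer force crosses zero upwards at each of its
zeros, because the Jacobian of the two forces is `hessianDet`, which is positive there, as is the
derivative of the inner force in a. A continuous function with only upward crossings has at most one
zero.

The crux is `hessianDet_pos`: the determinant is positive at every equilibrium. If the stiffness u =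
-f' is nonnegative at 2b, this is immediate. Otherwise the margins where a is near 0 or near b are
treated by hand, and the rest by interval arithmetic: the two equations fix the masses up to scale,
so on each box of a grid either no positive masses are possible or the determinant is positive.

For equal mirror masses the same determinant controls the full Hessian. The form splits into
variations of (a, b) and variations moving mirror points together; the second block is positive
because u > 0 on (0, π/2] and u(b - a) + u(a + b) > 0. Local minimality follows from a second order
comparison in each pair distance. -/

/-- The potential of a pair of points at angular difference `x`. -/
noncomputable def pairPotential (x : ℝ) : ℝ := 1 / mutualDist x + mutualDist x ^ 2 / 2

/-- The second derivative of `pairPotential`. -/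
noncomputable def stiffness (x : ℝ) : ℝ :=
  cos x + 2 / mutualDist x ^ 3 - 1 / (4 * mutualDist x)

/-! ### Half-angle formulas and derivatives -/

theorem mutualDist_neg (x : ℝ) : mutualDist (-x) = mutualDist x := by
  simp [mutualDist, neg_div, sin_neg]

theorem force_neg (x : ℝ) : force (-x) = -force x := by
  simp [force, mutualDist_neg]

theorem force_zero : force 0 = 0 := by simp [force]

theorem sin_half_pos {x : ℝ} (h0 : 0 < x) (h1 : x ≤ π) : 0 < sin (x / 2) :=
  sin_pos_of_pos_of_lt_pi (by linarith) (by linarith [pi_pos])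

theorem mutualDist_of_sin_pos {x : ℝ} (h : 0 < sin (x / 2)) : mutualDist x = 2 * sin (x / 2) := by
  rw [mutualDist, abs_of_pos h]

theorem cos_eq_half (x : ℝ) : cos x = 1 - 2 * sin (x / 2) ^ 2 := by
  have h := cos_two_mul (x / 2)
  have h2 := sin_sq_add_cos_sq (x / 2)
  rw [mul_div_cancel₀ x (two_ne_zero)] at h
  linarith

theorem sin_eq_half (x : ℝ) : sin x = 2 * sin (x / 2) * cos (x / 2) := by
  have h := sin_two_mul (x / 2)
  rwa [mul_div_cancel₀ x (two_ne_zero)] at h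

/-- Where the half-angle sine is positive the absolute value disappears, and everything is rational
in the sine and cosine of x / 2. Derivatives, signs and table checks all use this form. -/
theorem force_eq_half {x : ℝ} (h : 0 < sin (x / 2)) :
    force x = cos (x / 2) * (1 - 8 * sin (x / 2) ^ 3) / (4 * sin (x / 2) ^ 2) := by
  rw [force, mutualDist_of_sin_pos h, sin_eq_half]
  field_simp
  ring

theorem stiffness_eq_half {x : ℝ} (h : 0 < sin (x / 2)) :
    stiffness x = (8 * sin (x / 2) ^ 3 - 16 * sin (x / 2) ^ 5 + 2 - sin (x / 2) ^ 2)
      / (8 * sin (x / 2) ^ 3) := by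
  rw [stiffness, mutualDist_of_sin_pos h, cos_eq_half]
  field_simp
  ring

theorem hasDerivAt_sin_half (x : ℝ) :
    HasDerivAt (fun y : ℝ => sin (y / 2)) (cos (x / 2) / 2) x := by
  have := ((hasDerivAt_id x).div_const 2).sin
  simpa [div_eq_mul_inv] using this

theorem hasDerivAt_cos_half (x : ℝ) :
    HasDerivAt (fun y : ℝ => cos (y / 2)) (-sin (x / 2) / 2) x := by
  have := ((hasDerivAt_id x).div_const 2).cos
  simpa [div_eq_mul_inv] using this

theorem eventually_sin_half_pos {x : ℝ} (h : 0 < sin (x / 2)) :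
    ∀ᶠ y in nhds x, 0 < sin (y / 2) :=
  (hasDerivAt_sin_half x).continuousAt.eventually (lt_mem_nhds h)

theorem hasDerivAt_pairPotential {x : ℝ} (h : 0 < sin (x / 2)) :
    HasDerivAt pairPotential (-force x) x := by
  have hs := hasDerivAt_sin_half x
  have hr := hs.const_mul 2
  have hp := ((hasDerivAt_const x (1 : ℝ)).div hr (by positivity)).add ((hr.pow 2).div_const 2)
  refine (hp.congr_of_eventuallyEq ?_).congr_deriv ?_
  · filter_upwards [eventually_sin_half_pos h] with y hy
    simp only [pairPotential, mutualDist_of_sin_pos hy, Pi.add_apply, Pi.div_apply, Pi.pow_apply]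
  · rw [force_eq_half h]
    field_simp
    ring

theorem hasDerivAt_force {x : ℝ} (h : 0 < sin (x / 2)) :
    HasDerivAt force (-stiffness x) x := by
  have hs := hasDerivAt_sin_half x
  have hc := hasDerivAt_cos_half x
  have hp := (hc.mul (((hs.pow 3).const_mul 8).const_sub 1)).div ((hs.pow 2).const_mul 4)
    (show 4 * sin (x / 2) ^ 2 ≠ 0 by positivity)
  refine (hp.congr_of_eventuallyEq ?_).congr_deriv ?_
  · filter_upwards [eventually_sin_half_pos h] with y hy
    rw [force_eq_half hy]
    rfl
  · rw [stiffness_eq_half h]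
    have h2 : cos (x / 2) ^ 2 = 1 - sin (x / 2) ^ 2 := by
      linarith [sin_sq_add_cos_sq (x / 2)]
    simp only [Pi.mul_apply, Pi.pow_apply]
    generalize cos (x / 2) = c at *
    generalize sin (x / 2) = d at *
    field_simp
    ring_nf
    rw [h2]
    ring

/-! ### Monotonicity and signs of the stiffness and the force -/

theorem sin_half_strictMono {x y : ℝ} (h0 : 0 < x) (hxy : x < y) (h1 : y ≤ π) :
    sin (x / 2) < sin (y / 2) :=
  sin_lt_sin_of_lt_of_le_pi_div_two (by linarith [pi_pos]) (by linarith) (by linarith)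

/-- With S = sin (x / 2) and w = 1 / S, the stiffness is 1 - 2 S² + w³/4 - w/8, and w³/4 - w/8
increases for w ≥ 1. -/
theorem stiffness_lt {x y : ℝ} (h0 : 0 < x) (hxy : x < y) (h1 : y ≤ π) :
    stiffness y < stiffness x := by
  have hx := sin_half_pos h0 (hxy.le.trans h1)
  have hlt := sin_half_strictMono h0 hxy h1
  have hy := hx.trans hlt
  have hy1 := sin_le_one (y / 2)
  have e : ∀ z, 0 < sin (z / 2) → stiffness z =
      1 - 2 * sin (z / 2) ^ 2 + (sin (z / 2))⁻¹ ^ 3 / 4 - (sin (z / 2))⁻¹ / 8 := by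
    intro z hz
    rw [stiffness_eq_half hz]
    field_simp
    ring
  rw [e x hx, e y hy]
  have hi : (sin (y / 2))⁻¹ < (sin (x / 2))⁻¹ := by gcongr
  have hi1 : 1 ≤ (sin (y / 2))⁻¹ := (one_le_inv₀ hy).2 hy1
  generalize (sin (y / 2))⁻¹ = v at *
  generalize (sin (x / 2))⁻¹ = w at *
  have hsq : sin (x / 2) ^ 2 < sin (y / 2) ^ 2 := by gcongr
  have h3 : 0 < (w - v) * (2 * (w ^ 2 + w * v + v ^ 2) - 1) := by
    apply mul_pos (by linarith)
    nlinarith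
  nlinarith

theorem stiffness_anti {x y : ℝ} (h0 : 0 < x) (hxy : x ≤ y) (h1 : y ≤ π) :
    stiffness y ≤ stiffness x := by
  rcases hxy.eq_or_lt with rfl | h
  · exact le_rfl
  · exact (stiffness_lt h0 h h1).le

theorem stiffness_pi : stiffness π = -(7 / 8) := by
  have h : sin (π / 2) = 1 := sin_pi_div_two
  rw [stiffness_eq_half (by rw [h]; norm_num), h]
  norm_num

theorem neg_seven_eighths_le_stiffness {x : ℝ} (h0 : 0 < x) (h1 : x ≤ π) :
    -(7 / 8) ≤ stiffness x :=
  stiffness_pi ▸ stiffness_anti h0 h1 le_rfl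

/-- The stiffness exceeds the cosine, since 2 / r³ > 1 / (4 r) for r ≤ 2, and the cosines of
supplementary angles cancel. -/
theorem stiffness_add_stiffness_pi_sub_pos {x : ℝ} (h0 : 0 < x) (h1 : x < π) :
    0 < stiffness x + stiffness (π - x) := by
  have key : ∀ z : ℝ, 0 < z → z < π → cos z < stiffness z := by
    intro z hz0 hz1
    have h := sin_half_pos hz0 hz1.le
    have hle := sin_le_one (z / 2)
    rw [stiffness, mutualDist_of_sin_pos h]
    have : 1 / (4 * (2 * sin (z / 2))) < 2 / (2 * sin (z / 2)) ^ 3 := by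
      rw [div_lt_div_iff₀ (by positivity) (by positivity)]
      nlinarith [mul_pos h h, mul_pos h (mul_pos h h)]
    linarith
  have := key x h0 h1
  have := key (π - x) (by linarith) (by linarith)
  rw [cos_pi_sub] at this
  linarith

theorem stiffness_add_pos {x y : ℝ} (hx : 0 < x) (hy : 0 < y) (h : x + y ≤ π) :
    0 < stiffness x + stiffness y := by
  have h1 := stiffness_add_stiffness_pi_sub_pos hy (by linarith)
  have h2 := stiffness_anti hx (show x ≤ π - y by linarith) (by linarith)
  linarith

theorem stiffness_pos {x : ℝ} (h0 : 0 < x) (h1 : x ≤ π / 2) : 0 < stiffness x := by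
  have := stiffness_add_pos h0 h0 (by linarith)
  linarith

theorem cos_half_nonneg {x : ℝ} (h0 : 0 < x) (h1 : x ≤ π) : 0 ≤ cos (x / 2) :=
  cos_nonneg_of_mem_Icc ⟨by linarith [pi_pos], by linarith⟩

theorem force_nonpos {x : ℝ} (h0 : π / 3 ≤ x) (h1 : x ≤ π) : force x ≤ 0 := by
  have hp := pi_pos
  have h := sin_half_pos (show 0 < x by linarith) h1
  have hs : 1 / 2 ≤ sin (x / 2) := by
    rw [← sin_pi_div_six]
    exact sin_le_sin_of_le_of_le_pi_div_two (by linarith) (by linarith) (by linarith)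
  have hc := cos_half_nonneg (show 0 < x by linarith) h1
  rw [force_eq_half h]
  have : (1 / 2) ^ 3 ≤ sin (x / 2) ^ 3 := by gcongr
  have : 1 - 8 * sin (x / 2) ^ 3 ≤ 0 := by linarith
  exact div_nonpos_of_nonpos_of_nonneg (mul_nonpos_of_nonneg_of_nonpos hc this) (by positivity)

theorem neg_one_le_force {x : ℝ} (h0 : 0 < x) (h1 : x ≤ π) : -1 ≤ force x := by
  have h := sin_half_pos h0 h1
  rw [force, mutualDist_of_sin_pos h]
  have h2 : 0 ≤ sin x := sin_nonneg_of_mem_Icc ⟨h0.le, h1⟩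
  have h3 := sin_le_one x
  have : 0 ≤ sin x * (1 / (2 * sin (x / 2)) ^ 3) := by positivity
  linarith

/-- The force is not monotone up to π. Spreading the two angles symmetrically from their midpoint c,
the difference of forces has as derivative the sum of two stiffnesses at angles with sum x + y ≤ π,
which is positive. -/
theorem force_lt_force {x y : ℝ} (h0 : 0 < x) (hxy : x < y) (h : x + y ≤ π) :
    force y < force x := by
  set c := (x + y) / 2 with hc
  set d := (y - x) / 2 with hd
  have hcont : ∀ t ∈ Set.Icc 0 d, HasDerivAt (fun t => force (c - t) - force (c + t))
      (stiffness (c - t) + stiffness (c + t)) t := by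
    intro t ht
    have h1 := (hasDerivAt_force (sin_half_pos (x := c - t) (by linarith [ht.2])
      (by linarith [ht.1]))).comp t ((hasDerivAt_id t).const_sub c)
    have h2 := (hasDerivAt_force (sin_half_pos (x := c + t) (by linarith [ht.1])
      (by linarith [ht.2]))).comp t ((hasDerivAt_id t).const_add c)
    refine (h1.sub h2).congr_deriv ?_
    ring
  have hm : StrictMonoOn (fun t => force (c - t) - force (c + t)) (Set.Icc 0 d) := by
    apply strictMonoOn_of_deriv_pos (convex_Icc 0 d)
    · intro t ht
      exact (hcont t ht).continuousAt.continuousWithinAt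
    · intro t ht
      rw [interior_Icc] at ht
      rw [(hcont t ⟨ht.1.le, ht.2.le⟩).deriv]
      exact stiffness_add_pos (by linarith [ht.2]) (by linarith [ht.1]) (by linarith)
  have hd0 : 0 < d := by linarith
  have := hm ⟨le_rfl, hd0.le⟩ ⟨hd0.le, le_rfl⟩ hd0
  have e1 : c - d = x := by linarith
  have e2 : c + d = y := by linarith
  simp only [e1, e2, sub_zero, add_zero, sub_self] at this
  linarith

/-- The force decreases while the stiffness is nonnegative. -/
theorem force_anti {x y : ℝ} (h0 : 0 < x) (hxy : x ≤ y) (h1 : y ≤ π) (hs : 0 ≤ stiffness y) :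
    force y ≤ force x := by
  have hd : ∀ t ∈ Set.Icc x y, HasDerivAt force (-stiffness t) t := fun t ht =>
    hasDerivAt_force (sin_half_pos (h0.trans_le ht.1) (ht.2.trans h1))
  have : AntitoneOn force (Set.Icc x y) := by
    apply antitoneOn_of_deriv_nonpos (convex_Icc x y)
    · exact fun t ht => (hd t ht).continuousAt.continuousWithinAt
    · exact fun t ht => (hd t (interior_subset ht)).differentiableAt.differentiableWithinAt
    · intro t ht
      have ht' := interior_subset ht
      rw [(hd t ht').deriv]
      linarith [stiffness_anti (h0.trans_le ht'.1) ht'.2 h1]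
  exact this ⟨le_rfl, hxy⟩ ⟨hxy, le_rfl⟩ hxy

theorem sub_le_force {x y : ℝ} (h0 : 0 < x) (hxy : x ≤ y) (h1 : y ≤ π) :
    force x - stiffness x * (y - x) ≤ force y := by
  have hd : ∀ t ∈ Set.Icc x y, HasDerivAt force (-stiffness t) t := fun t ht =>
    hasDerivAt_force (sin_half_pos (h0.trans_le ht.1) (ht.2.trans h1))
  have hc : ContinuousOn force (Set.Icc x y) := fun t ht =>
    (hd t ht).continuousAt.continuousWithinAt
  have hi : DifferentiableOn ℝ force (interior (Set.Icc x y)) := fun t ht =>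
    (hd t (interior_subset ht)).differentiableAt.differentiableWithinAt
  have lower := (convex_Icc x y).mul_sub_le_image_sub_of_le_deriv hc hi (C := -stiffness x)
    (fun t ht => by
      have ht' := interior_subset ht
      rw [(hd t ht').deriv]
      linarith [stiffness_anti h0 ht'.1 (ht'.2.trans h1)]) x ⟨le_rfl, hxy⟩ y ⟨hxy, le_rfl⟩ hxy
  linarith

/-- The force increases while the stiffness is nonpositive. -/
theorem force_mono {x y : ℝ} (h0 : 0 < x) (hxy : x ≤ y) (h1 : y ≤ π) (hs : stiffness x ≤ 0) :
    force x ≤ force y := by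
  have hd : ∀ t ∈ Set.Icc x y, HasDerivAt force (-stiffness t) t := fun t ht =>
    hasDerivAt_force (sin_half_pos (h0.trans_le ht.1) (ht.2.trans h1))
  have : MonotoneOn force (Set.Icc x y) := by
    apply monotoneOn_of_deriv_nonneg (convex_Icc x y)
    · exact fun t ht => (hd t ht).continuousAt.continuousWithinAt
    · exact fun t ht => (hd t (interior_subset ht)).differentiableAt.differentiableWithinAt
    · intro t ht
      have ht' := interior_subset ht
      rw [(hd t ht').deriv]
      linarith [stiffness_anti h0 ht'.1 (ht'.2.trans h1)]
  exact this ⟨le_rfl, hxy⟩ ⟨hxy, le_rfl⟩ hxy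

/-! ### Integer intervals -/

/-- An interval of real numbers with integer end points. -/
structure IntInterval where
  lo : ℤ
  hi : ℤ

namespace IntInterval

def Mem (x : ℝ) (I : IntInterval) : Prop := (I.lo : ℝ) ≤ x ∧ x ≤ I.hi

def add (I J : IntInterval) : IntInterval := ⟨I.lo + J.lo, I.hi + J.hi⟩

def sub (I J : IntInterval) : IntInterval := ⟨I.lo - J.hi, I.hi - J.lo⟩

def mul (I J : IntInterval) : IntInterval :=
  ⟨min (min (I.lo * J.lo) (I.lo * J.hi)) (min (I.hi * J.lo) (I.hi * J.hi)),
   max (max (I.lo * J.lo) (I.lo * J.hi)) (max (I.hi * J.lo) (I.hi * J.hi))⟩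

/-- The interval of the nonnegative members. -/
def nonneg (I : IntInterval) : IntInterval := ⟨max I.lo 0, I.hi⟩

variable {x y : ℝ} {I J : IntInterval}

theorem Mem.add (hx : Mem x I) (hy : Mem y J) : Mem (x + y) (I.add J) := by
  simp only [Mem, IntInterval.add, Int.cast_add]
  exact ⟨add_le_add hx.1 hy.1, add_le_add hx.2 hy.2⟩

theorem Mem.sub (hx : Mem x I) (hy : Mem y J) : Mem (x - y) (I.sub J) := by
  simp only [Mem, IntInterval.sub, Int.cast_sub]
  exact ⟨sub_le_sub hx.1 hy.2, sub_le_sub hx.2 hy.1⟩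

theorem Mem.nonneg (hx : Mem x I) (h : 0 ≤ x) : Mem x I.nonneg := by
  simp only [Mem, IntInterval.nonneg, Int.cast_max, Int.cast_zero]
  exact ⟨max_le hx.1 h, hx.2⟩

theorem Mem.mul (hx : Mem x I) (hy : Mem y J) : Mem (x * y) (I.mul J) := by
  obtain ⟨h1, h2⟩ := hx
  obtain ⟨h3, h4⟩ := hy
  simp only [Mem, IntInterval.mul, Int.cast_min, Int.cast_max, Int.cast_mul, min_le_iff, le_max_iff]
  constructor
  · rcases le_total 0 y with hy | hy
    · rcases le_total 0 (I.lo : ℝ) with h | h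
      · exact Or.inl (Or.inl (by nlinarith))
      · exact Or.inl (Or.inr (by nlinarith))
    · rcases le_total 0 (I.hi : ℝ) with h | h
      · exact Or.inr (Or.inl (by nlinarith))
      · exact Or.inr (Or.inr (by nlinarith))
  · rcases le_total 0 y with hy | hy
    · rcases le_total 0 (I.hi : ℝ) with h | h
      · exact Or.inr (Or.inr (by nlinarith))
      · exact Or.inr (Or.inl (by nlinarith))
    · rcases le_total 0 (I.lo : ℝ) with h | h
      · exact Or.inl (Or.inr (by nlinarith))
      · exact Or.inl (Or.inl (by nlinarith))

end IntInterval

/-! ### The determinant of the reduced Hessian -/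

/-- The determinant of the reduced Hessian of a symmetric configuration, as a function of the
masses `p` (outer), `q` (inner), `s` (middle) and of the stiffnesses at the angular differences
`b - a`, `a + b`, `a`, `b`, `2 a` and `2 b`. -/
def hessianDet (p q s um up ua ub u2a u2b : ℝ) : ℝ :=
  (q * (um + up) + (s * ub + 2 * p * u2b)) * (p * (um + up) + (s * ua + 2 * q * u2a)) -
    p * q * (um - up) ^ 2

open IntInterval in
/-- An enclosure of `hessianDet` for nonnegative masses. -/
def hessianDetInterval (p q s um up ua ub u2a u2b : IntInterval) : IntInterval :=
  let two : IntInterval := ⟨2, 2⟩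
  let four : IntInterval := ⟨4, 4⟩
  let t := um.add up
  ((t.mul ((two.mul ((q.mul q).mul u2a)).add (two.mul ((p.mul p).mul u2b)))).add
    (four.mul ((p.mul q).mul ((um.mul up).add (u2a.mul u2b))))).add
  ((((q.mul s).mul ((t.mul ua).add (two.mul (ub.mul u2a)))).add
    ((p.mul s).mul ((t.mul ub).add (two.mul (ua.mul u2b))))).add ((s.mul s).mul (ua.mul ub)))

-- The enclosure evaluates an expanded form in which (um + up)² - (um - up)² has become 4 um up. The
-- square of um, which is large when the inner and outer angles are close, then never has to cancel
-- between intervals.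
open IntInterval in
theorem mem_hessianDetInterval {p q s um up ua ub u2a u2b : ℝ}
    {P Q S Um Up Ua Ub U2a U2b : IntInterval} (hp : Mem p P) (hq : Mem q Q) (hs : Mem s S)
    (hum : Mem um Um) (hup : Mem up Up) (hua : Mem ua Ua) (hub : Mem ub Ub)
    (hu2a : Mem u2a U2a) (hu2b : Mem u2b U2b) :
    Mem (hessianDet p q s um up ua ub u2a u2b) (hessianDetInterval P Q S Um Up Ua Ub U2a U2b) := by
  have two : Mem (2 : ℝ) ⟨2, 2⟩ := by constructor <;> norm_num
  have four : Mem (4 : ℝ) ⟨4, 4⟩ := by constructor <;> norm_num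
  have t := hum.add hup
  have := ((t.mul ((two.mul ((hq.mul hq).mul hu2a)).add (two.mul ((hp.mul hp).mul hu2b)))).add
    (four.mul ((hp.mul hq).mul ((hum.mul hup).add (hu2a.mul hu2b))))).add
    ((((hq.mul hs).mul ((t.mul hua).add (two.mul (hub.mul hu2a)))).add
    ((hp.mul hs).mul ((t.mul hub).add (two.mul (hua.mul hu2b))))).add
      ((hs.mul hs).mul (hua.mul hub)))
  refine cast (congrArg (Mem · _) ?_) this
  simp only [hessianDet]
  ring

/-- Decides from enclosures of the forces and the stiffnesses that no positive masses satisfy the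
equilibrium equations or that they make `hessianDet` positive: the mass vector is parallel to the
cross product of the coefficient vectors of the two equations. -/
def boxCheck (fm fp fa fb f2a f2b um up ua ub u2a u2b : IntInterval) : Bool :=
  let P := (fa.mul (fm.add fp)).sub (fb.mul f2a)
  let Q := (fb.mul (fp.sub fm)).sub (f2b.mul fa)
  let S := (f2b.mul f2a).add ((fm.add fp).mul (fm.sub fp))
  (decide (0 < P.lo) || decide (0 < Q.lo) || decide (0 < S.lo)) &&
  (decide (P.hi ≤ 0) || decide (Q.hi ≤ 0) || decide (S.hi ≤ 0) ||
    decide (0 < (hessianDetInterval P.nonneg Q.nonneg S.nonneg um up ua ub u2a u2b).lo))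

open IntInterval in
theorem hessianDet_pos_of_boxCheck {p q s fm fp fa fb f2a f2b um up ua ub u2a u2b : ℝ}
    {Fm Fp Fa Fb F2a F2b Um Up Ua Ub U2a U2b : IntInterval}
    (hfm : Mem fm Fm) (hfp : Mem fp Fp) (hfa : Mem fa Fa) (hfb : Mem fb Fb)
    (hf2a : Mem f2a F2a) (hf2b : Mem f2b F2b)
    (hum : Mem um Um) (hup : Mem up Up) (hua : Mem ua Ua) (hub : Mem ub Ub)
    (hu2a : Mem u2a U2a) (hu2b : Mem u2b U2b) (hp : 0 < p) (hq : 0 < q) (hs : 0 < s)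
    (h1 : q * (fm + fp) + s * fb + p * f2b = 0) (h2 : q * f2a + s * fa + p * (fp - fm) = 0)
    (hc : boxCheck Fm Fp Fa Fb F2a F2b Um Up Ua Ub U2a U2b = true) :
    0 < hessianDet p q s um up ua ub u2a u2b := by
  have hP := (hfa.mul (hfm.add hfp)).sub (hfb.mul hf2a)
  have hQ := (hfb.mul (hfp.sub hfm)).sub (hf2b.mul hfa)
  have hS := (hf2b.mul hf2a).add ((hfm.add hfp).mul (hfm.sub hfp))
  simp only [boxCheck, Bool.and_eq_true, Bool.or_eq_true, decide_eq_true_eq] at hc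
  obtain ⟨hpos, hc⟩ := hc
  set P := fa * (fm + fp) - fb * f2a with hPdef
  set Q := fb * (fp - fm) - f2b * fa with hQdef
  set S := f2b * f2a + (fm + fp) * (fm - fp) with hSdef
  have e1 : p * Q = q * P := by rw [hPdef, hQdef]; linear_combination fb * h2 - fa * h1
  have e2 : p * S = s * P := by
    rw [hPdef, hSdef]; linear_combination f2a * h1 - (fm + fp) * h2
  -- The factor by which the cross product exceeds the mass vector. Its sign is unknown a priori;
  -- the first conjunct of the check makes one coordinate, hence the factor, positive.
  set μ := P / p with hμ
  have eP : P = μ * p := by rw [hμ]; field_simp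
  have eQ : Q = μ * q := by
    rw [hμ]; field_simp; linarith
  have eS : S = μ * s := by
    rw [hμ]; field_simp; linarith
  have hμpos : 0 < μ := by
    rcases hpos with (h | h) | h
    · have : 0 < μ * p := eP ▸ lt_of_lt_of_le (by exact_mod_cast h) hP.1
      exact pos_of_mul_pos_left this hp.le
    · have : 0 < μ * q := eQ ▸ lt_of_lt_of_le (by exact_mod_cast h) hQ.1
      exact pos_of_mul_pos_left this hq.le
    · have : 0 < μ * s := eS ▸ lt_of_lt_of_le (by exact_mod_cast h) hS.1
      exact pos_of_mul_pos_left this hs.le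
  have pP : 0 < P := eP ▸ mul_pos hμpos hp
  have pQ : 0 < Q := eQ ▸ mul_pos hμpos hq
  have pS : 0 < S := eS ▸ mul_pos hμpos hs
  rcases hc with ((h | h) | h) | h
  · exact absurd (hP.2.trans (by exact_mod_cast h)) (not_le.2 pP)
  · exact absurd (hQ.2.trans (by exact_mod_cast h)) (not_le.2 pQ)
  · exact absurd (hS.2.trans (by exact_mod_cast h)) (not_le.2 pS)
  · have := (mem_hessianDetInterval (hP.nonneg pP.le) (hQ.nonneg pQ.le) (hS.nonneg pS.le)
      hum hup hua hub hu2a hu2b).1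
    have h3 : 0 < hessianDet P Q S um up ua ub u2a u2b :=
      lt_of_lt_of_le (by exact_mod_cast h) this
    -- The determinant is homogeneous of degree two in the masses, so the unknown scale does not
    -- affect its sign.
    have h4 : hessianDet P Q S um up ua ub u2a u2b =
        μ ^ 2 * hessianDet p q s um up ua ub u2a u2b := by
      rw [eP, eQ, eS]
      simp only [hessianDet]
      ring
    rw [h4] at h3
    exact pos_of_mul_pos_right h3 (by positivity)

/-! ### Tables of the force and the stiffness -/

/-- The mesh of the grid of angles, about `1.637` degrees; the sine and the cosine of its half
are rational. -/
noncomputable def mesh : ℝ := 4 * arctan (1 / 140)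

/-- `⌊1000 f(k mesh)⌋` for `1 ≤ k ≤ 109`. -/
def forceTable : List ℤ :=
  [0, 1224971, 306161, 135988, 76409, 48817, 33816, 24760, 18872, 14827, 11926, 9773, 8128, 6843,
   5818, 4986, 4301, 3729, 3246, 2834, 2478, 2170, 1899, 1661, 1450, 1261, 1092, 939, 801, 675,
   560, 455, 359, 270, 188, 113, 42, -23, -83, -139, -191, -240, -285, -328, -367, -403, -437,
   -469, -498, -525, -550, -573, -594, -614, -631, -647, -662, -674, -686, -695, -704, -711,
   -717, -721, -724, -726, -727, -727, -725, -723, -719, -714, -709, -702, -694, -686, -677,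
   -666, -655, -643, -630, -617, -602, -587, -572, -555, -538, -521, -502, -483, -464, -444,
   -424, -403, -381, -359, -337, -315, -292, -269, -245, -221, -197, -173, -148, -124, -99, -74,
   -49, -24]

/-- `⌊1000 u(k mesh)⌋` for `1 ≤ k ≤ 109`, where `u` is the stiffness. -/
def stiffnessTable : List ℤ :=
  [0, 85755374, 10720295, 3177084, 1340906, 687025, 397997, 250994, 168464, 118601, 86715, 65381,
   50570, 39967, 32175, 26321, 21836, 18342, 15578, 13362, 11564, 10089, 8867, 7844, 6982, 6249,
   5621, 5079, 4609, 4198, 3837, 3518, 3234, 2981, 2753, 2548, 2362, 2192, 2037, 1895, 1764,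
   1642, 1529, 1424, 1325, 1233, 1145, 1063, 985, 911, 840, 772, 708, 646, 586, 529, 473, 420,
   368, 318, 270, 223, 177, 133, 90, 48, 7, -33, -71, -109, -146, -181, -216, -250, -283, -315,
   -346, -376, -405, -434, -461, -488, -514, -539, -563, -586, -609, -630, -651, -671, -690,
   -708, -725, -741, -756, -771, -784, -797, -808, -819, -829, -838, -846, -853, -859, -864,
   -868, -871, -874, -875]

/-- Checks the entries of the tables at one angle, whose half has sine `s / M` and cosine
`c / M`. -/
def entryCheck (c s M F U : ℤ) : Bool :=
  decide (0 < s) &&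
  decide (F * (4 * s ^ 2 * M ^ 2) ≤ 1000 * (c * (M ^ 3 - 8 * s ^ 3))) &&
  decide (1000 * (c * (M ^ 3 - 8 * s ^ 3)) ≤ (F + 1) * (4 * s ^ 2 * M ^ 2)) &&
  decide (U * (8 * s ^ 3 * M ^ 2) ≤
    1000 * (8 * s ^ 3 * M ^ 2 - 16 * s ^ 5 + 2 * M ^ 5 - s ^ 2 * M ^ 3)) &&
  decide (1000 * (8 * s ^ 3 * M ^ 2 - 16 * s ^ 5 + 2 * M ^ 5 - s ^ 2 * M ^ 3) ≤
    (U + 1) * (8 * s ^ 3 * M ^ 2))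

/-- Checks the tables, `c / M` and `s / M` being the cosine and the sine of half the angle which
precedes the first entry. -/
def tableCheck : List ℤ → List ℤ → ℤ → ℤ → ℤ → Bool
  | F :: Fs, U :: Us, c, s, M =>
    let c' := c * 19599 - s * 280
    let s' := c * 280 + s * 19599
    let M' := M * 19601
    entryCheck c' s' M' F U && tableCheck Fs Us c' s' M'
  | _, _, _, _, _ => true

/-- Angle addition keeps the half-angle cosine and sine rational, with a power of 19601 as
denominator, so each entry amounts to integer inequalities. The tail drops the dummy entry at index
0; the arguments 1, 0, 1 encode the angle 0. -/
theorem tableCheck_tables : tableCheck forceTable.tail stiffnessTable.tail 1 0 1 = true := by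
  decide +kernel

theorem le_and_le_of_entryCheck {c s M F U : ℤ} (h : entryCheck c s M F U = true) (hM : 0 < M)
    {x : ℝ} (hs : sin (x / 2) = s / M) (hc : cos (x / 2) = c / M) :
    0 < s ∧ ((F : ℝ) ≤ 1000 * force x ∧ 1000 * force x ≤ F + 1) ∧
      ((U : ℝ) ≤ 1000 * stiffness x ∧ 1000 * stiffness x ≤ U + 1) := by
  simp only [entryCheck, Bool.and_eq_true, decide_eq_true_eq] at h
  obtain ⟨⟨⟨⟨h0, h1⟩, h2⟩, h3⟩, h4⟩ := h
  have hM' : (0 : ℝ) < M := by exact_mod_cast hM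
  have hs' : (0 : ℝ) < s := by exact_mod_cast h0
  have hpos : 0 < sin (x / 2) := by rw [hs]; positivity
  have ef : 1000 * force x =
      1000 * (c * (M ^ 3 - 8 * s ^ 3)) / (4 * (s : ℝ) ^ 2 * (M : ℝ) ^ 2) := by
    rw [force_eq_half hpos, hs, hc]
    field_simp
  have eu : 1000 * stiffness x =
      1000 * (8 * s ^ 3 * M ^ 2 - 16 * s ^ 5 + 2 * M ^ 5 - s ^ 2 * M ^ 3) /
        (8 * (s : ℝ) ^ 3 * (M : ℝ) ^ 2) := by
    rw [stiffness_eq_half hpos, hs]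
    field_simp
  refine ⟨h0, ?_, ?_⟩
  · rw [ef, le_div_iff₀ (by positivity), div_le_iff₀ (by positivity)]
    exact ⟨by exact_mod_cast h1, by exact_mod_cast h2⟩
  · rw [eu, le_div_iff₀ (by positivity), div_le_iff₀ (by positivity)]
    exact ⟨by exact_mod_cast h3, by exact_mod_cast h4⟩

theorem sin_mesh_half : sin (mesh / 2) = 280 / 19601 := by
  have : mesh / 2 = 2 * arctan (1 / 140) := by rw [mesh]; ring
  rw [this, sin_two_mul, sin_arctan, cos_arctan]
  have h : √(1 + (1 / 140 : ℝ) ^ 2) * √(1 + (1 / 140 : ℝ) ^ 2) = 1 + (1 / 140 : ℝ) ^ 2 :=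
    mul_self_sqrt (by positivity)
  have h' : 2 * (1 / 140 / √(1 + (1 / 140 : ℝ) ^ 2)) * (1 / √(1 + (1 / 140 : ℝ) ^ 2)) =
      2 / 140 / (√(1 + (1 / 140 : ℝ) ^ 2) * √(1 + (1 / 140 : ℝ) ^ 2)) := by
    field_simp
  rw [h', h]
  norm_num

theorem cos_mesh_half : cos (mesh / 2) = 19599 / 19601 := by
  have : mesh / 2 = 2 * arctan (1 / 140) := by rw [mesh]; ring
  rw [this, cos_two_mul, cos_sq_arctan]
  norm_num

/-- The lower bound is just enough for 55 steps to cover π/2, as 55 · 0.02856 = 1.5708; the upper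
bound keeps 109 steps below π. -/
theorem mesh_bounds : 0.02856 < mesh ∧ mesh < 0.0285715 := by
  have h0 : (0 : ℝ) < arctan (1 / 140) := arctan_pos.2 (by norm_num)
  have hs : sin (mesh / 2) = 280 / 19601 := sin_mesh_half
  have h1 : arctan (1 / 140) < 1 / 140 := by
    have := lt_tan h0 (arctan_lt_pi_div_two _)
    rwa [tan_arctan] at this
  have h2 : sin (mesh / 2) < mesh / 2 := sin_lt (by rw [mesh]; linarith)
  rw [hs] at h2
  rw [mesh] at *
  constructor <;> norm_num at * <;> linarith

theorem tableCheck_sound : ∀ (Fs Us : List ℤ) (c s M : ℤ) (x : ℝ),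
    tableCheck Fs Us c s M = true → 0 < M → sin (x / 2) = s / M → cos (x / 2) = c / M →
    ∀ k (hF : k < Fs.length) (hU : k < Us.length),
      (((Fs[k] : ℤ) : ℝ) ≤ 1000 * force (x + (k + 1) * mesh) ∧
        1000 * force (x + (k + 1) * mesh) ≤ (Fs[k] : ℤ) + 1) ∧
      (((Us[k] : ℤ) : ℝ) ≤ 1000 * stiffness (x + (k + 1) * mesh) ∧
        1000 * stiffness (x + (k + 1) * mesh) ≤ (Us[k] : ℤ) + 1)
  | [], _, _, _, _, _, _, _, _, _, k, hF, _ => absurd hF (by simp)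
  | _ :: _, [], _, _, _, _, _, _, _, _, k, _, hU => absurd hU (by simp)
  | F :: Fs, U :: Us, c, s, M, x, h, hM, hs, hc, k, hF, hU => by
    simp only [tableCheck, Bool.and_eq_true] at h
    have hM' : (0 : ℝ) < M := by exact_mod_cast hM
    have hs' : sin ((x + mesh) / 2) = ((c * 280 + s * 19599 : ℤ) : ℝ) / ((M * 19601 : ℤ) : ℝ) := by
      rw [add_div, sin_add, hs, hc, sin_mesh_half, cos_mesh_half]
      push_cast
      field_simp
      ring
    have hc' : cos ((x + mesh) / 2) = ((c * 19599 - s * 280 : ℤ) : ℝ) / ((M * 19601 : ℤ) : ℝ) := by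
      rw [add_div, cos_add, hs, hc, sin_mesh_half, cos_mesh_half]
      push_cast
      field_simp
    cases k with
    | zero =>
      have := le_and_le_of_entryCheck h.1 (by positivity) hs' hc'
      simpa using this.2
    | succ k =>
      have := tableCheck_sound Fs Us _ _ _ (x + mesh) h.2 (by positivity) hs' hc' k
        (by simpa using hF) (by simpa using hU)
      have e : x + mesh + (k + 1) * mesh = x + ((k + 1 : ℕ) + 1) * mesh := by push_cast; ring
      rw [e] at this
      simpa using this

/-- The entry of `forceTable` at `k`, or `-1` beyond the table. -/
def forceEntry (k : ℕ) : ℤ := forceTable.getD k (-1)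

/-- The entry of `stiffnessTable` at `k`, or `-876` beyond the table. -/
def stiffnessEntry (k : ℕ) : ℤ := stiffnessTable.getD k (-876)

theorem entry_bounds {k : ℕ} (h1 : 1 ≤ k) (h2 : k ≤ 109) :
    ((forceEntry k : ℝ) ≤ 1000 * force (k * mesh) ∧
      1000 * force (k * mesh) ≤ forceEntry k + 1) ∧
    ((stiffnessEntry k : ℝ) ≤ 1000 * stiffness (k * mesh) ∧
      1000 * stiffness (k * mesh) ≤ stiffnessEntry k + 1) := by
  obtain ⟨n, rfl⟩ := Nat.exists_eq_add_of_le' h1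
  have hF : n < forceTable.tail.length := by
    simp only [forceTable, List.tail_cons, List.length_cons, List.length_nil]; omega
  have hU : n < stiffnessTable.tail.length := by
    simp only [stiffnessTable, List.tail_cons, List.length_cons, List.length_nil]; omega
  have := tableCheck_sound _ _ 1 0 1 0 tableCheck_tables one_pos (by simp) (by simp) n hF hU
  have eF : forceTable.tail[n]'hF = forceEntry (n + 1) := by
    rw [forceEntry, List.getD_eq_getElem _ _ (by simp at hF; omega), List.getElem_tail]
  have eU : stiffnessTable.tail[n]'hU = stiffnessEntry (n + 1) := by
    rw [stiffnessEntry, List.getD_eq_getElem _ _ (by simp at hU; omega), List.getElem_tail]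
  rw [eF, eU, zero_add] at this
  exact_mod_cast this

theorem mul_mesh_le_pi {k : ℕ} (hk : k ≤ 109) : k * mesh ≤ π := by
  have h := mesh_bounds
  have hp := pi_gt_d4
  have : (k : ℝ) ≤ 109 := by exact_mod_cast hk
  nlinarith

/-- The stiffness changes sign between the grid angles 66 and 67, so the force decreases up to the
first and increases from the second on. -/
theorem stiffness_mesh_nonneg {k : ℕ} (h1 : 1 ≤ k) (h2 : k ≤ 66) : 0 ≤ stiffness (k * mesh) := by
  have hm := mesh_bounds
  have h66 : (0 : ℝ) ≤ stiffness ((66 : ℕ) * mesh) := by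
    have := (entry_bounds (k := 66) (by norm_num) (by norm_num)).2.1
    have e : stiffnessEntry 66 = 7 := by decide
    rw [e] at this
    norm_num at *
    linarith
  refine h66.trans (stiffness_anti ?_ ?_ (mul_mesh_le_pi (by norm_num)))
  · have : (1 : ℝ) ≤ k := by exact_mod_cast h1
    nlinarith
  · have : (k : ℝ) ≤ (66 : ℕ) := by exact_mod_cast h2
    nlinarith

theorem stiffness_mesh_nonpos {k : ℕ} (h1 : 67 ≤ k) (h2 : k ≤ 109) : stiffness (k * mesh) ≤ 0 := by
  have hm := mesh_bounds
  have h67 : stiffness ((67 : ℕ) * mesh) ≤ 0 := by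
    have := (entry_bounds (k := 67) (by norm_num) (by norm_num)).2.2
    have e : stiffnessEntry 67 = -33 := by decide
    rw [e] at this
    norm_num at *
    linarith
  refine (stiffness_anti ?_ ?_ (mul_mesh_le_pi h2)).trans h67
  · push_cast; linarith
  · have : ((67 : ℕ) : ℝ) ≤ k := by exact_mod_cast h1
    nlinarith

/-- An enclosure of `1000 f` between the grid angles of indices `k` and `l`. -/
def forceInterval (k l : ℕ) : IntInterval :=
  if l ≤ 66 then ⟨forceEntry l, forceEntry k + 1⟩
  else if 67 ≤ k then ⟨forceEntry k, forceEntry l + 1⟩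
  -- The box may contain the minimum of the force, near the entries -727; -750 leaves a margin.
  else ⟨-750, max (forceEntry k + 1) (forceEntry l + 1)⟩

/-- An enclosure of `1000 u`, `u` being the stiffness, between the grid angles of indices `k`
and `l`. -/
def stiffnessInterval (k l : ℕ) : IntInterval := ⟨stiffnessEntry l, stiffnessEntry k + 1⟩

theorem mem_stiffnessInterval {k l : ℕ} (hk : 1 ≤ k) (hk' : k ≤ 109) {x : ℝ}
    (h1 : k * mesh ≤ x) (h2 : x ≤ l * mesh) (hx : x ≤ π) :
    IntInterval.Mem (1000 * stiffness x) (stiffnessInterval k l) := by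
  have hm := mesh_bounds
  have hk0 : 0 < k * mesh := by
    have : (1 : ℝ) ≤ k := by exact_mod_cast hk
    nlinarith
  simp only [IntInterval.Mem, stiffnessInterval, Int.cast_add, Int.cast_one]
  constructor
  · rcases le_or_gt l 109 with hl | hl
    · have hl1 : 1 ≤ l := by
        by_contra h0
        have : l = 0 := by omega
        subst this
        norm_num at h2
        linarith
      have := (entry_bounds hl1 hl).2.1
      have := stiffness_anti (hk0.trans_le h1) h2 (mul_mesh_le_pi hl)
      linarith
    -- Beyond the table the default lies below -875, the value of 1000 u at π and its minimum.
    · have e : stiffnessEntry l = -876 := by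
        rw [stiffnessEntry, List.getD_eq_default]
        simp only [stiffnessTable, List.length_cons, List.length_nil]; omega
      rw [e]
      have := neg_seven_eighths_le_stiffness (hk0.trans_le h1) hx
      norm_num
      linarith
  · have := (entry_bounds hk hk').2.2
    have := stiffness_anti hk0 h1 hx
    linarith

theorem force_le_entry_right {l : ℕ} {x : ℝ} (h1 : (66 : ℕ) * mesh ≤ x) (h2 : x ≤ l * mesh) (hx : x ≤ π) (hs : stiffness x ≤ 0) :
    1000 * force x ≤ forceEntry l + 1 := by
  have hm := mesh_bounds
  push_cast at h1
  have hx0 : 0 < x := by linarith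
  rcases le_or_gt l 109 with hl | hl
  · have hl1 : 1 ≤ l := by
      by_contra h0
      have : l = 0 := by omega
      subst this
      norm_num at h2
      linarith
    have := (entry_bounds hl1 hl).1.2
    have := force_mono hx0 h2 (mul_mesh_le_pi hl) hs
    linarith
  -- The default -1 turns the upper end into 0, which is valid because the force is nonpositive from
  -- π/3 to π.
  · have e : forceEntry l = -1 := by
      rw [forceEntry, List.getD_eq_default]
      simp only [forceTable, List.length_cons, List.length_nil]; omega
    rw [e]
    have := force_nonpos (x := x) (by linarith [pi_lt_d2]) hx
    norm_num
    linarith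

theorem mem_forceInterval {k l : ℕ} (hk : 1 ≤ k) (hk' : k ≤ 109) {x : ℝ}
    (h1 : k * mesh ≤ x) (h2 : x ≤ l * mesh) (hx : x ≤ π) :
    IntInterval.Mem (1000 * force x) (forceInterval k l) := by
  have hm := mesh_bounds
  have hk0 : 0 < k * mesh := by
    have : (1 : ℝ) ≤ k := by exact_mod_cast hk
    nlinarith
  have hx0 := hk0.trans_le h1
  have bk := (entry_bounds hk hk').1
  have below : x ≤ (66 : ℕ) * mesh → 1000 * force x ≤ forceEntry k + 1 := by
    intro h66
    have hs : 0 ≤ stiffness x :=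
      (stiffness_mesh_nonneg (by norm_num) le_rfl).trans
        (stiffness_anti hx0 h66 (mul_mesh_le_pi (by norm_num)))
    have := force_anti hk0 h1 hx hs
    linarith
  have above : (67 : ℕ) * mesh ≤ x → 1000 * force x ≤ forceEntry l + 1 := by
    intro h67
    exact force_le_entry_right (by push_cast at *; linarith) h2 hx
      ((stiffness_anti (by push_cast; linarith) h67 hx).trans
        (stiffness_mesh_nonpos le_rfl (by norm_num)))
  rw [forceInterval]
  split_ifs with c1 c2
  · have hl1 : 1 ≤ l := by
      by_contra h0
      have : l = 0 := by omega
      subst this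
      norm_num at h2
      linarith
    have hl66 : (l : ℝ) ≤ (66 : ℕ) := by exact_mod_cast c1
    simp only [IntInterval.Mem, Int.cast_add, Int.cast_one]
    refine ⟨?_, below (h2.trans (by nlinarith))⟩
    have := (entry_bounds hl1 (by omega)).1.1
    have := force_anti hx0 h2 (mul_mesh_le_pi (by omega)) (stiffness_mesh_nonneg hl1 c1)
    linarith
  · have hk67 : ((67 : ℕ) : ℝ) ≤ k := by exact_mod_cast c2
    simp only [IntInterval.Mem, Int.cast_add, Int.cast_one]
    refine ⟨?_, above (le_trans (by nlinarith) h1)⟩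
    have := force_mono hk0 h1 hx (stiffness_mesh_nonpos c2 hk')
    linarith
  · have e66 : (-727 : ℝ) ≤ 1000 * force ((66 : ℕ) * mesh) := by
      have := (entry_bounds (k := 66) (by norm_num) (by norm_num)).1.1
      have e : forceEntry 66 = -727 := by decide
      rw [e] at this
      norm_num at *
      linarith
    have e67 : (-727 : ℝ) ≤ 1000 * force ((67 : ℕ) * mesh) := by
      have := (entry_bounds (k := 67) (by norm_num) (by norm_num)).1.1
      have e : forceEntry 67 = -727 := by decide
      rw [e] at this
      norm_num at *
      linarith
    have u66 : 1000 * stiffness ((66 : ℕ) * mesh) ≤ 8 := by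
      have := (entry_bounds (k := 66) (by norm_num) (by norm_num)).2.2
      have e : stiffnessEntry 66 = 7 := by decide
      rw [e] at this
      norm_num at *
      linarith
    have h66pi : ((66 : ℕ) : ℝ) * mesh ≤ π := mul_mesh_le_pi (by norm_num)
    have h67pi : ((67 : ℕ) : ℝ) * mesh ≤ π := mul_mesh_le_pi (by norm_num)
    simp only [IntInterval.Mem, Int.cast_max, Int.cast_add, Int.cast_one, Int.cast_neg,
      Int.cast_ofNat, le_max_iff]
    rcases le_total x ((66 : ℕ) * mesh) with h66 | h66
    · refine ⟨?_, Or.inl (below h66)⟩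
      have := force_anti hx0 h66 h66pi (stiffness_mesh_nonneg (by norm_num) le_rfl)
      linarith
    rcases le_total ((67 : ℕ) * mesh) x with h67 | h67
    · refine ⟨?_, Or.inr (above h67)⟩
      have := force_mono (by push_cast; linarith) h67 hx (stiffness_mesh_nonpos le_rfl (by norm_num))
      linarith
    -- Between the two grid angles around the minimum, the tangent at angle 66 bounds the force
    -- below: 1000 f falls by at most 8 over a length at most 1.
    · have hl := sub_le_force (by push_cast; linarith) h66 hx
      have hlen : x - (66 : ℕ) * mesh ≤ 1 := by push_cast at *; linarith
      have hlen0 : 0 ≤ x - (66 : ℕ) * mesh := by linarith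
      have lower : -750 ≤ 1000 * force x := by nlinarith
      refine ⟨lower, ?_⟩
      rcases le_total 0 (stiffness x) with hs | hs
      · left
        have := force_anti hk0 h1 hx hs
        linarith
      · right
        exact force_le_entry_right h66 h2 hx hs

/-- `boxCheck` for the angles `a` and `b` in the boxes of indices `i` and `j` of the grid. -/
def gridBoxCheck (i j : ℕ) : Bool :=
  boxCheck (forceInterval (j - i - 1) (j - i + 1)) (forceInterval (i + j) (i + j + 2))
    (forceInterval i (i + 1)) (forceInterval j (j + 1))
    (forceInterval (2 * i) (2 * i + 2)) (forceInterval (2 * j) (2 * j + 2))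
    (stiffnessInterval (j - i - 1) (j - i + 1)) (stiffnessInterval (i + j) (i + j + 2))
    (stiffnessInterval i (i + 1)) (stiffnessInterval j (j + 1))
    (stiffnessInterval (2 * i) (2 * i + 2)) (stiffnessInterval (2 * j) (2 * j + 2))

/-- Below index 33 for b, the angle 2 b stays within 66 steps, where no stiffness is negative; index
55 lies beyond π/2. The margins of four steps avoid the singularities at a = 0 and a = b. -/
theorem gridBoxCheck_eq_true :
    ∀ j < 55, 33 ≤ j → ∀ i < j - 3, 4 ≤ i → gridBoxCheck i j = true := by
  decide +kernel

/-! ### Positivity of the determinant at equilibria -/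

/-- The reduced equilibrium equations of a symmetric configuration with the angles
`b, a, 0, -a, -b` and the masses `p, q, s, q, p`. -/
structure ReducedEquilibrium (p q s a b : ℝ) : Prop where
  outer : q * (force (b - a) + force (a + b)) + s * force b + p * force (2 * b) = 0
  inner : q * force (2 * a) + s * force a + p * (force (a + b) - force (b - a)) = 0

theorem hessianDet_eq (p q s um up ua ub u2a u2b : ℝ) :
    hessianDet p q s um up ua ub u2a u2b =
      4 * (p * q) * (um * up) + (um + up) * (q * (s * ua + 2 * q * u2a) + p * (s * ub + 2 * p * u2b))
        + (s * ub + 2 * p * u2b) * (s * ua + 2 * q * u2a) := by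
  simp only [hessianDet]; ring

theorem hessianDet_pos_of_nonneg {p q s um up ua ub u2a u2b : ℝ} (hp : 0 < p) (hq : 0 < q)
    (hs : 0 < s) (hum : 0 < um) (hup : 0 < up) (hua : 0 < ua) (hub : 0 < ub) (hu2a : 0 < u2a)
    (hu2b : 0 ≤ u2b) : 0 < hessianDet p q s um up ua ub u2a u2b := by
  rw [hessianDet_eq]
  positivity

theorem force_le_one {x : ℝ} (h : 29 * mesh ≤ x) (hx : x ≤ π) : force x ≤ 1 := by
  have hm := mesh_bounds
  rcases le_total (π / 3) x with h3 | h3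
  · linarith [force_nonpos h3 hx]
  · have h1 := force_anti (x := 29 * mesh) (by linarith) h hx
      (stiffness_pos (by linarith) (by linarith [pi_pos])).le
    have h2 := (entry_bounds (k := 29) (by norm_num) (by norm_num)).1.2
    have e : forceEntry 29 = 675 := by decide
    rw [e] at h2
    norm_num at h2
    linarith

theorem half_le_stiffness {x : ℝ} (h0 : 0 < x) (hx : x ≤ π / 2) : 1 / 2 ≤ stiffness x := by
  have hm := mesh_bounds
  have h1 := stiffness_anti (y := (55 : ℕ) * mesh) h0
    (by push_cast; linarith [pi_lt_d6]) (mul_mesh_le_pi (by norm_num))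
  have h2 := (entry_bounds (k := 55) (by norm_num) (by norm_num)).2.1
  have e : stiffnessEntry 55 = 529 := by decide
  rw [e] at h2
  norm_num at h1 h2
  linarith

/-- The force at b - a is at least 76 and the other forces are of size at most 1 in the directions
needed, so equilibrium makes p and q small compared with s. The only possibly negative term of the
determinant, 4 p q um up, is then outweighed by the multiple of um q s contained in the second term.
-/
theorem hessianDet_pos_of_near_diagonal {p q s a b : ℝ} (hp : 0 < p) (hq : 0 < q) (hs : 0 < s)
    (hab : a < b) (hb : b ≤ π / 2) (hbl : 33 * mesh ≤ b) (h : b - a ≤ 4 * mesh)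
    (he : ReducedEquilibrium p q s a b) :
    0 < hessianDet p q s (stiffness (b - a)) (stiffness (a + b)) (stiffness a) (stiffness b)
      (stiffness (2 * a)) (stiffness (2 * b)) := by
  have hm := mesh_bounds
  have hpi := pi_pos
  have b4 := entry_bounds (k := 4) (by norm_num) (by norm_num)
  have h4pi : ((4 : ℕ) : ℝ) * mesh ≤ π := mul_mesh_le_pi (by norm_num)
  have e4 : forceEntry 4 = 76409 := by decide
  have e4' : stiffnessEntry 4 = 1340906 := by decide
  rw [e4, e4'] at b4
  have hfm : 76 ≤ force (b - a) := by
    have := force_anti (x := b - a) (y := (4 : ℕ) * mesh) (by linarith) (by push_cast; linarith)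
      h4pi (stiffness_mesh_nonneg (by norm_num) (by norm_num))
    norm_num at b4 this
    linarith
  have hum : 1 ≤ stiffness (b - a) := by
    have := stiffness_anti (x := b - a) (y := (4 : ℕ) * mesh) (by linarith) (by push_cast; linarith)
      h4pi
    norm_num at b4 this
    linarith
  have ha : 29 * mesh ≤ a := by linarith
  have ha0 : 0 < a := by linarith
  have f1 := neg_one_le_force (x := a + b) (by linarith) (by linarith)
  have f1' := force_le_one (x := a + b) (by linarith) (by linarith)
  have f2 := neg_one_le_force (x := 2 * b) (by linarith) (by linarith)
  have f3 := neg_one_le_force (x := b) (by linarith) (by linarith)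
  have f4 := force_le_one (x := 2 * a) (by linarith) (by linarith)
  have f5 := force_le_one (x := a) (by linarith) (by linarith)
  have hua := half_le_stiffness ha0 (by linarith)
  have hub := half_le_stiffness (show 0 < b by linarith) hb
  have hup := neg_seven_eighths_le_stiffness (x := a + b) (by linarith) (by linarith)
  have hu2a := neg_seven_eighths_le_stiffness (x := 2 * a) (by linarith) (by linarith)
  have hu2b := neg_seven_eighths_le_stiffness (x := 2 * b) (by linarith) (by linarith)
  obtain ⟨h1, h2⟩ := he
  rw [hessianDet_eq]
  generalize force (b - a) = fm at *
  generalize force (a + b) = fp at *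
  generalize force (2 * b) = f2b at *
  generalize force (2 * a) = f2a at *
  generalize force b = fb at *
  generalize force a = fa at *
  generalize stiffness (b - a) = um at *
  generalize stiffness (a + b) = up at *
  generalize stiffness (2 * b) = u2b at *
  generalize stiffness (2 * a) = u2a at *
  generalize stiffness b = ub at *
  generalize stiffness a = ua at *
  have k1 : q * 75 ≤ s + p := by
    have := mul_le_mul_of_nonneg_left (show 75 ≤ fm + fp by linarith) hq.le
    have := mul_le_mul_of_nonneg_left f3 hs.le
    have := mul_le_mul_of_nonneg_left f2 hp.le
    linarith
  have k2 : p * 75 ≤ s + q := by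
    have := mul_le_mul_of_nonneg_left (show 75 ≤ fm - fp by linarith) hp.le
    have := mul_le_mul_of_nonneg_left f5 hs.le
    have := mul_le_mul_of_nonneg_left f4 hq.le
    linarith
  have hX : s * (2 / 5) ≤ s * ub + 2 * p * u2b := by
    have := mul_le_mul_of_nonneg_left hub hs.le
    have := mul_le_mul_of_nonneg_left hu2b hp.le
    linarith
  have hY : s * (2 / 5) ≤ s * ua + 2 * q * u2a := by
    have := mul_le_mul_of_nonneg_left hua hs.le
    have := mul_le_mul_of_nonneg_left hu2a hq.le
    linarith
  generalize s * ub + 2 * p * u2b = X at *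
  generalize s * ua + 2 * q * u2a = Y at *
  have hXp : 0 < X := by linarith
  have hYp : 0 < Y := by linarith
  have t1 : um / 8 * (q * (s * (2 / 5))) ≤ (um + up) * (q * Y + p * X) := by
    apply mul_le_mul (by linarith) _ (by positivity) (by linarith)
    have := mul_le_mul_of_nonneg_left hY hq.le
    have := mul_pos hp hXp
    linarith
  have t2 : 4 * (p * q) * (um * -(7 / 8)) ≤ 4 * (p * q) * (um * up) := by
    have := mul_le_mul_of_nonneg_left hup (show 0 ≤ um by linarith)
    gcongr
  have t3 : 0 < um / 8 * (q * (s * (2 / 5))) + 4 * (p * q) * (um * -(7 / 8)) + X * Y := by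
    have : 0 ≤ um * q := by positivity
    have h5 : 0 ≤ (um * q) * (s * (1 / 20) - p * (7 / 2)) := mul_nonneg this (by linarith)
    nlinarith [mul_pos hXp hYp]
  linarith

/-- The strong repulsion among the three central points can only be balanced by a large outer mass:
the inner equation gives p ≥ 9 (q + s). The outer equation then fails. -/
theorem not_reducedEquilibrium_of_small {p q s a b : ℝ} (hp : 0 < p) (hq : 0 < q) (hs : 0 < s)
    (ha : 0 < a) (hb : b ≤ π / 2) (hbl : 33 * mesh ≤ b) (h : a ≤ 4 * mesh) :
    ¬ ReducedEquilibrium p q s a b := by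
  rintro ⟨h1, h2⟩
  have hm := mesh_bounds
  have hpi := pi_pos
  have hpi3 : π / 3 ≤ 37 * mesh := by linarith [pi_lt_d6]
  have b8 := (entry_bounds (k := 8) (by norm_num) (by norm_num)).1.1
  have e8 : forceEntry 8 = 18872 := by decide
  rw [e8] at b8
  have h8 : ∀ x, 0 < x → x ≤ 8 * mesh → 18 ≤ force x := by
    intro x hx0 hx
    have := force_anti (x := x) (y := (8 : ℕ) * mesh) hx0 (by push_cast; linarith)
      (mul_mesh_le_pi (by norm_num)) (stiffness_mesh_nonneg (by norm_num) (by norm_num))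
    norm_num at b8 this
    linarith
  have f2a := h8 (2 * a) (by linarith) (by linarith)
  have fa := h8 a ha (by linarith)
  have fm := force_le_one (x := b - a) (by linarith) (by linarith)
  have fp := neg_one_le_force (x := a + b) (by linarith) (by linarith)
  have fp' := force_le_one (x := a + b) (by linarith) (by linarith)
  have fb := force_le_one (x := b) (by linarith) (by linarith)
  have k1 : 18 * (q + s) ≤ p * 2 := by
    have := mul_le_mul_of_nonneg_left (show force (b - a) - force (a + b) ≤ 2 by linarith) hp.le
    have := mul_le_mul_of_nonneg_left f2a hq.le
    have := mul_le_mul_of_nonneg_left fa hs.le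
    linarith
  rcases le_total (b - a) (π / 3) with h3 | h3
  -- Here b is at most 37 + 4 steps, whence 82 for 2 b. The outer points attract each other with
  -- strength at least 0.6 p, more than the other terms can balance.
  · have := (mem_forceInterval (k := 66) (l := 82) (x := 2 * b) (by norm_num) (by norm_num)
      (by push_cast; linarith) (by push_cast; linarith) (by linarith)).2
    have e : (forceInterval 66 82).hi = -601 := by decide
    rw [e] at this
    have f2b : force (2 * b) ≤ -(6 / 10) := by norm_num at this; linarith
    have := mul_le_mul_of_nonneg_left f2b hp.le
    have := mul_le_mul_of_nonneg_left (show force (b - a) + force (a + b) ≤ 2 by linarith) hq.le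
    have := mul_le_mul_of_nonneg_left fb hs.le
    linarith
  -- All terms of the outer equation are nonpositive, hence zero. The outer points then exert no net
  -- force in the inner equation, whose remaining terms are positive.
  · have g1 := force_nonpos (x := b - a) h3 (by linarith)
    have g2 := force_nonpos (x := a + b) (by linarith) (by linarith)
    have g3 := mul_nonpos_of_nonneg_of_nonpos hs.le
      (force_nonpos (x := b) (by linarith) (by linarith))
    have g4 := mul_nonpos_of_nonneg_of_nonpos hp.le
      (force_nonpos (x := 2 * b) (by linarith) (by linarith))
    have g5 : 0 ≤ q * (force (b - a) + force (a + b)) := by linarith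
    have g6 := nonneg_of_mul_nonneg_right g5 hq
    have g7 : force (a + b) - force (b - a) = 0 := by linarith
    rw [g7, mul_zero] at h2
    have := mul_pos hq (show 0 < force (2 * a) by linarith)
    have := mul_pos hs (show 0 < force a by linarith)
    linarith

theorem hessianDet_pos_of_grid {p q s a b : ℝ} (hp : 0 < p) (hq : 0 < q) (hs : 0 < s)
    (hb : b ≤ π / 2) (hbl : 33 * mesh ≤ b) (ha : 4 * mesh ≤ a)
    (h : 4 * mesh ≤ b - a) (he : ReducedEquilibrium p q s a b) :
    0 < hessianDet p q s (stiffness (b - a)) (stiffness (a + b)) (stiffness a) (stiffness b)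
      (stiffness (2 * a)) (stiffness (2 * b)) := by
  have hm := mesh_bounds
  have hm0 : 0 < mesh := by linarith
  set i := ⌊a / mesh⌋₊ with hi
  set j := ⌊b / mesh⌋₊ with hj
  have i1 : i * mesh ≤ a := by
    rw [← le_div_iff₀ hm0]; exact Nat.floor_le (div_nonneg (by linarith) hm0.le)
  have i2 : a ≤ (i + 1) * mesh := by
    rw [← div_le_iff₀ hm0]; exact (Nat.lt_floor_add_one _).le
  have j1 : j * mesh ≤ b := by
    rw [← le_div_iff₀ hm0]; exact Nat.floor_le (div_nonneg (by linarith) hm0.le)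
  have j2 : b ≤ (j + 1) * mesh := by
    rw [← div_le_iff₀ hm0]; exact (Nat.lt_floor_add_one _).le
  have i4 : 4 ≤ i := Nat.le_floor (by rw [le_div_iff₀ hm0]; push_cast; linarith)
  have j33 : 33 ≤ j := Nat.le_floor (by rw [le_div_iff₀ hm0]; push_cast; linarith)
  have j55 : j < 55 := by
    rw [hj, Nat.floor_lt (div_nonneg (by linarith) hm0.le), div_lt_iff₀ hm0]
    push_cast; linarith [pi_lt_d6]
  have hij : i + 4 ≤ j := by
    apply Nat.le_floor
    rw [le_div_iff₀ hm0]
    push_cast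
    linarith
  have hc := gridBoxCheck_eq_true j j55 j33 i (by omega) i4
  have e1 : ((j - i - 1 : ℕ) : ℝ) = j - i - 1 := by
    rw [Nat.cast_sub (by omega), Nat.cast_sub (by omega)]; simp
  have e2 : ((j - i + 1 : ℕ) : ℝ) = j - i + 1 := by
    rw [Nat.cast_add, Nat.cast_sub (by omega)]; simp
  have key : ∀ {k l : ℕ} {x : ℝ}, 1 ≤ k → k ≤ 109 → k * mesh ≤ x → x ≤ l * mesh → x ≤ π →
      IntInterval.Mem (1000 * force x) (forceInterval k l) ∧
        IntInterval.Mem (1000 * stiffness x) (stiffnessInterval k l) :=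
    fun h1 h2 h3 h4 h5 => ⟨mem_forceInterval h1 h2 h3 h4 h5, mem_stiffnessInterval h1 h2 h3 h4 h5⟩
  have m1 := key (k := j - i - 1) (l := j - i + 1) (x := b - a) (by omega) (by omega)
    (by rw [e1]; linarith) (by rw [e2]; linarith) (by linarith)
  have m2 := key (k := i + j) (l := i + j + 2) (x := a + b) (by omega) (by omega)
    (by push_cast; linarith) (by push_cast; linarith) (by linarith)
  have m3 := key (k := i) (l := i + 1) (x := a) (by omega) (by omega)
    i1 (by push_cast; linarith) (by linarith)
  have m4 := key (k := j) (l := j + 1) (x := b) (by omega) (by omega)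
    j1 (by push_cast; linarith) (by linarith)
  have m5 := key (k := 2 * i) (l := 2 * i + 2) (x := 2 * a) (by omega) (by omega)
    (by push_cast; linarith) (by push_cast; linarith) (by linarith)
  have m6 := key (k := 2 * j) (l := 2 * j + 2) (x := 2 * b) (by omega) (by omega)
    (by push_cast; linarith) (by push_cast; linarith) (by linarith)
  have := hessianDet_pos_of_boxCheck m1.1 m2.1 m3.1 m4.1 m5.1 m6.1 m1.2 m2.2 m3.2 m4.2 m5.2 m6.2
    hp hq hs (by linear_combination 1000 * he.outer) (by linear_combination 1000 * he.inner) hc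
  have e : hessianDet p q s (1000 * stiffness (b - a)) (1000 * stiffness (a + b))
      (1000 * stiffness a) (1000 * stiffness b) (1000 * stiffness (2 * a))
      (1000 * stiffness (2 * b)) = 1000 ^ 2 * hessianDet p q s (stiffness (b - a))
        (stiffness (a + b)) (stiffness a) (stiffness b) (stiffness (2 * a))
        (stiffness (2 * b)) := by
    simp only [hessianDet]; ring
  rw [e] at this
  exact pos_of_mul_pos_right this (by norm_num)

/-- The largest of the six angles is 2 b, so a nonnegative stiffness there makes all the others
positive. A negative one forces 2 b beyond 66 steps, the range covered by the two margins and the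
grid. -/
theorem hessianDet_pos {p q s a b : ℝ} (hp : 0 < p) (hq : 0 < q) (hs : 0 < s)
    (ha : 0 < a) (hab : a < b) (hb : b ≤ π / 2) (he : ReducedEquilibrium p q s a b) :
    0 < hessianDet p q s (stiffness (b - a)) (stiffness (a + b)) (stiffness a) (stiffness b)
      (stiffness (2 * a)) (stiffness (2 * b)) := by
  have hm := mesh_bounds
  rcases le_or_gt 0 (stiffness (2 * b)) with h | h
  · have key : ∀ x, 0 < x → x < 2 * b → 0 < stiffness x := fun x h0 h1 =>
      h.trans_lt (stiffness_lt h0 h1 (by linarith))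
    exact hessianDet_pos_of_nonneg hp hq hs (key _ (by linarith) (by linarith))
      (key _ (by linarith) (by linarith)) (key _ (by linarith) (by linarith))
      (key _ (by linarith) (by linarith)) (key _ (by linarith) (by linarith)) h
  have hbl : 33 * mesh ≤ b := by
    by_contra hlt
    have h66 := stiffness_mesh_nonneg (k := 66) (by norm_num) le_rfl
    have := stiffness_anti (x := 2 * b) (y := (66 : ℕ) * mesh) (by linarith)
      (by push_cast; linarith) (mul_mesh_le_pi (by norm_num))
    linarith
  rcases le_total (b - a) (4 * mesh) with h1 | h1
  · exact hessianDet_pos_of_near_diagonal hp hq hs hab hb hbl h1 he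
  rcases le_total a (4 * mesh) with h2 | h2
  · exact absurd he (not_reducedEquilibrium_of_small hp hq hs ha hb hbl h2)
  exact hessianDet_pos_of_grid hp hq hs hb hbl h2 h1 he

/-! ### Zeros of functions along curves -/

/-- If `F` and `G` vanish at a point of the plane where `F` increases in the first variable and
where the Jacobian is positive, then on the zero set of `F` near the point `G` has the sign of
the increment of the second variable. -/
theorem eventually_sign_of_jacobian_pos {F G : ℝ × ℝ → ℝ} {a₀ b₀ α β γ ε : ℝ}
    (hF : HasFDerivAt F (α • ContinuousLinearMap.fst ℝ ℝ ℝ + β • ContinuousLinearMap.snd ℝ ℝ ℝ)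
      (a₀, b₀))
    (hG : HasFDerivAt G (γ • ContinuousLinearMap.fst ℝ ℝ ℝ + ε • ContinuousLinearMap.snd ℝ ℝ ℝ)
      (a₀, b₀))
    (hF0 : F (a₀, b₀) = 0) (hG0 : G (a₀, b₀) = 0) (hα : 0 < α) (hdet : 0 < α * ε - β * γ) :
    ∀ᶠ z in 𝓝 (a₀, b₀), F z = 0 → (b₀ < z.2 → 0 < G z) ∧ (z.2 < b₀ → G z < 0) := by
  -- On the zero set of F the linearization, with error at most α / 2 times |x| + |y|, gives |x| ≤ C
  -- |y|: the second increment controls the first.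
  set C : ℝ := 2 * |β| / α + 1 with hC
  have hC0 : 0 < C := by positivity
  set Δ := α * ε - β * γ with hΔ
  -- This combination eliminates the first variable to first order: its linear part is Δ times the
  -- second increment, and on the zero set of F it equals α G.
  have hK : HasFDerivAt (fun z => α * G z - γ * F z)
      (α • (γ • ContinuousLinearMap.fst ℝ ℝ ℝ + ε • ContinuousLinearMap.snd ℝ ℝ ℝ) -
        γ • (α • ContinuousLinearMap.fst ℝ ℝ ℝ + β • ContinuousLinearMap.snd ℝ ℝ ℝ))
      (a₀, b₀) := (hG.const_mul α).sub (hF.const_mul γ)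
  have oF := hF.isLittleO.def (show 0 < α / 2 by positivity)
  have oK := hK.isLittleO.def (show 0 < Δ / (2 * (C + 1)) by positivity)
  filter_upwards [oF, oK] with z h1 h2 hz
  have hnorm : ‖z - (a₀, b₀)‖ ≤ |z.1 - a₀| + |z.2 - b₀| := by
    rw [Prod.norm_def]
    simp only [Prod.fst_sub, Prod.snd_sub, Real.norm_eq_abs]
    exact max_le (le_add_of_nonneg_right (abs_nonneg _)) (le_add_of_nonneg_left (abs_nonneg _))
  simp only [hz, hF0, hG0, add_apply, sub_apply, smul_apply, ContinuousLinearMap.coe_fst', ContinuousLinearMap.coe_snd',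
    Prod.fst_sub, Prod.snd_sub, smul_eq_mul, Real.norm_eq_abs, mul_zero, sub_zero, zero_sub,
    abs_neg] at h1 h2
  set x := z.1 - a₀
  set y := z.2 - b₀
  have hx : |x| ≤ C * |y| := by
    have h3 : α * |x| ≤ |α * x + β * y| + |β| * |y| := by
      have : |α * x| ≤ |α * x + β * y| + |β * y| := by
        have := abs_sub (α * x + β * y) (β * y)
        rwa [add_sub_cancel_right] at this
      rwa [abs_mul, abs_mul, abs_of_pos hα] at this
    have h4 : |α * x + β * y| ≤ α / 2 * (|x| + |y|) := h1.trans (by gcongr)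
    have h5 : α / 2 * |x| ≤ α / 2 * (C * |y|) := by
      have : α / 2 * (C * |y|) = |β| * |y| + α / 2 * |y| := by
        rw [hC]; field_simp
      rw [this]; linarith
    exact le_of_mul_le_mul_left h5 (by positivity)
  have h3 : |α * G z - Δ * y| ≤ Δ / 2 * |y| := by
    have e : α * G z - (α * (γ * x + ε * y) - γ * (α * x + β * y)) = α * G z - Δ * y := by
      rw [hΔ]; ring
    rw [e] at h2
    refine h2.trans ?_
    calc Δ / (2 * (C + 1)) * ‖z - (a₀, b₀)‖ ≤ Δ / (2 * (C + 1)) * (C * |y| + |y|) := by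
          gcongr; exact hnorm.trans (by linarith)
      _ = Δ / 2 * |y| := by field_simp
  rw [abs_le] at h3
  constructor
  · intro hlt
    have hy : 0 < y := sub_pos.2 hlt
    rw [abs_of_pos hy] at h3
    have : 0 < α * G z := by nlinarith [mul_pos hdet hy]
    exact pos_of_mul_pos_right this hα.le
  · intro hlt
    have hy : y < 0 := sub_neg.2 hlt
    rw [abs_of_neg hy] at h3
    have : 0 < α * (-G z) := by nlinarith [mul_pos hdet (neg_pos.2 hy)]
    linarith [pos_of_mul_pos_right this hα.le]

/-- A continuous function on an interval which crosses zero upwards at each of its zeros has at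
most one zero. -/
theorem not_two_upcrossings {h : ℝ → ℝ} {b₁ b₂ : ℝ} (hb : b₁ < b₂)
    (hc : ContinuousOn h (Set.Icc b₁ b₂)) (h1 : h b₁ = 0) (h2 : h b₂ = 0)
    (hup : ∀ b₀ ∈ Set.Icc b₁ b₂, h b₀ = 0 →
      ∀ᶠ b in 𝓝[Set.Icc b₁ b₂] b₀, (b₀ < b → 0 < h b) ∧ (b < b₀ → h b < 0)) : False := by
  have e1 := hup b₁ ⟨le_rfl, hb.le⟩ h1
  rw [eventually_nhdsWithin_iff, Metric.eventually_nhds_iff] at e1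
  obtain ⟨δ, hδ, e1⟩ := e1
  set c := min (b₁ + δ / 2) b₂ with hcdef
  have hc1 : b₁ < c := lt_min (by linarith) hb
  have hc2 : c ≤ b₂ := min_le_right _ _
  have hcδ : c ≤ b₁ + δ / 2 := min_le_left _ _
  have hhc : 0 < h c := (e1 (by rw [Real.dist_eq, abs_of_pos (by linarith)]; linarith)
    ⟨hc1.le, hc2⟩).1 hc1
  set Z := Set.Icc c b₂ ∩ h ⁻¹' Set.Iic 0 with hZ
  have hZc : IsCompact Z := by
    apply isCompact_Icc.of_isClosed_subset _ Set.inter_subset_left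
    exact (hc.mono (Set.Icc_subset_Icc_left hc1.le)).preimage_isClosed_of_isClosed isClosed_Icc
      isClosed_Iic
  -- The first return to zero after c: the function is positive just before it, which an upward
  -- crossing excludes.
  obtain ⟨d, hd, hmin⟩ := hZc.exists_isLeast ⟨b₂, ⟨hc2, le_rfl⟩, h2.le⟩
  have hcd : c < d := by
    rcases hd.1.1.eq_or_lt with h' | h'
    · exact absurd hd.2 (by rw [← h']; simpa using hhc)
    · exact h'
  have hpos : ∀ b, c < b → b < d → 0 < h b := by
    intro b hb1 hb2
    by_contra hle
    exact absurd (hmin ⟨⟨hb1.le, hb2.le.trans hd.1.2⟩, not_lt.1 hle⟩) (not_le.2 hb2)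
  have hdI : d ∈ Set.Icc b₁ b₂ := ⟨hc1.le.trans hd.1.1, hd.1.2⟩
  have hne : (𝓝[Set.Ioo c d] d).NeBot := right_nhdsWithin_Ioo_neBot hcd
  have hsub : Set.Ioo c d ⊆ Set.Icc b₁ b₂ := fun b hb' =>
    ⟨hc1.le.trans hb'.1.le, hb'.2.le.trans hd.1.2⟩
  have hd0 : h d = 0 := by
    refine le_antisymm hd.2 ?_
    have ht : Tendsto h (𝓝[Set.Ioo c d] d) (𝓝 (h d)) := (hc d hdI).mono_left (nhdsWithin_mono _ hsub)
    refine ge_of_tendsto ht ?_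
    filter_upwards [self_mem_nhdsWithin] with b hb'
    exact (hpos b hb'.1 hb'.2).le
  have e2 := (hup d hdI hd0).filter_mono (nhdsWithin_mono d hsub)
  obtain ⟨b, hb1, hb2⟩ := (e2.and self_mem_nhdsWithin).exists
  exact absurd (hb1.2 hb2.2) (not_lt.2 (hpos b hb2.1 hb2.2).le)

/-! ### The two components of the reduced gradient -/

/-- Half the derivative of the reduced potential in the inner angle `a`, divided by `q`. -/
noncomputable def innerForce (p q s a b : ℝ) : ℝ :=
  p * (force (b - a) - force (a + b)) - q * force (2 * a) - s * force a

/-- Half the derivative of the reduced potential in the outer angle `b`, divided by `p`. -/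
noncomputable def outerForce (p q s a b : ℝ) : ℝ :=
  -(q * (force (b - a) + force (a + b)) + s * force b + p * force (2 * b))

theorem hasFDerivAt_force_linear {a b k l : ℝ} (h : 0 < sin ((k * a + l * b) / 2)) :
    HasFDerivAt (fun z : ℝ × ℝ => force (k * z.1 + l * z.2))
      ((-stiffness (k * a + l * b)) •
        (k • ContinuousLinearMap.fst ℝ ℝ ℝ + l • ContinuousLinearMap.snd ℝ ℝ ℝ)) (a, b) := by
  have h1 : HasFDerivAt (fun z : ℝ × ℝ => k * z.1 + l * z.2)
      (k • ContinuousLinearMap.fst ℝ ℝ ℝ + l • ContinuousLinearMap.snd ℝ ℝ ℝ) (a, b) :=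
    (hasFDerivAt_fst.const_mul k).add (hasFDerivAt_snd.const_mul l)
  exact (hasDerivAt_force h).comp_hasFDerivAt (a, b) h1

theorem hasFDerivAt_innerForce (p q s : ℝ) {a b : ℝ} (ha : 0 < a) (hab : a < b)
    (hb : b ≤ π / 2) :
    HasFDerivAt (fun z : ℝ × ℝ => innerForce p q s z.1 z.2)
      ((p * (stiffness (b - a) + stiffness (a + b)) +
          (s * stiffness a + 2 * q * stiffness (2 * a))) • ContinuousLinearMap.fst ℝ ℝ ℝ +
        (p * (stiffness (a + b) - stiffness (b - a))) • ContinuousLinearMap.snd ℝ ℝ ℝ) (a, b) := by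
  have h1 := hasFDerivAt_force_linear (a := a) (b := b) (k := -1) (l := 1)
    (sin_half_pos (by linarith) (by linarith))
  have h2 := hasFDerivAt_force_linear (a := a) (b := b) (k := 1) (l := 1)
    (sin_half_pos (by linarith) (by linarith))
  have h3 := hasFDerivAt_force_linear (a := a) (b := b) (k := 2) (l := 0)
    (sin_half_pos (by linarith) (by linarith))
  have h4 := hasFDerivAt_force_linear (a := a) (b := b) (k := 1) (l := 0)
    (sin_half_pos (by linarith) (by linarith))
  have h := (((h1.sub h2).const_mul p).sub (h3.const_mul q)).sub (h4.const_mul s)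
  refine (h.congr_of_eventuallyEq (Eventually.of_forall fun z => ?_)).congr_fderiv ?_
  · simp [innerForce, neg_add_eq_sub]
  · ext
    · simp [neg_add_eq_sub]
      ring
    · simp [neg_add_eq_sub]

theorem hasFDerivAt_outerForce (p q s : ℝ) {a b : ℝ} (ha : 0 < a) (hab : a < b)
    (hb : b ≤ π / 2) :
    HasFDerivAt (fun z : ℝ × ℝ => outerForce p q s z.1 z.2)
      ((q * (stiffness (a + b) - stiffness (b - a))) • ContinuousLinearMap.fst ℝ ℝ ℝ +
        (q * (stiffness (b - a) + stiffness (a + b)) +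
          (s * stiffness b + 2 * p * stiffness (2 * b))) • ContinuousLinearMap.snd ℝ ℝ ℝ)
      (a, b) := by
  have h1 := hasFDerivAt_force_linear (a := a) (b := b) (k := -1) (l := 1)
    (sin_half_pos (by linarith) (by linarith))
  have h2 := hasFDerivAt_force_linear (a := a) (b := b) (k := 1) (l := 1)
    (sin_half_pos (by linarith) (by linarith))
  have h3 := hasFDerivAt_force_linear (a := a) (b := b) (k := 0) (l := 2)
    (sin_half_pos (by linarith) (by linarith))
  have h4 := hasFDerivAt_force_linear (a := a) (b := b) (k := 0) (l := 1)
    (sin_half_pos (by linarith) (by linarith))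
  have h := ((((h1.add h2).const_mul q).add (h4.const_mul s)).add (h3.const_mul p)).neg
  refine (h.congr_of_eventuallyEq (Eventually.of_forall fun z => ?_)).congr_fderiv ?_
  · simp [outerForce, neg_add_eq_sub]
  · ext <;> (simp [neg_add_eq_sub]; ring)

theorem hasDerivAt_innerForce (p q s : ℝ) {a b : ℝ} (ha : 0 < a) (hab : a < b)
    (hb : b ≤ π / 2) :
    HasDerivAt (fun x => innerForce p q s x b)
      (p * (stiffness (b - a) + stiffness (a + b)) +
          (s * stiffness a + 2 * q * stiffness (2 * a))) a := by
  have h := (hasFDerivAt_innerForce p q s ha hab hb).comp_hasDerivAt a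
    ((hasDerivAt_id a).prodMk (hasDerivAt_const a b))
  exact h.congr_deriv (by simp)

/-- Where cos a > 0, this says that f(a) / cos a has negative derivative. In S = sin (a / 2) the
difference of the two sides is a polynomial, positive for S > 0, over 8 S³. -/
theorem force_mul_sin_lt {a : ℝ} (h0 : 0 < a) (h1 : a ≤ π) :
    force a * sin a < stiffness a * cos a := by
  have h := sin_half_pos h0 h1
  have hle := sin_le_one (a / 2)
  rw [force_eq_half h, stiffness_eq_half h, sin_eq_half a, cos_eq_half a]
  have hc : cos (a / 2) ^ 2 = 1 - sin (a / 2) ^ 2 := by linarith [sin_sq_add_cos_sq (a / 2)]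
  set S := sin (a / 2)
  have e : (8 * S ^ 3 - 16 * S ^ 5 + 2 - S ^ 2) / (8 * S ^ 3) * (1 - 2 * S ^ 2) -
      cos (a / 2) * (1 - 8 * S ^ 3) / (4 * S ^ 2) * (2 * S * cos (a / 2)) =
      (8 * S ^ 3 + 2 - 9 * S ^ 2 + 6 * S ^ 4) / (8 * S ^ 3) := by
    have : cos (a / 2) * (1 - 8 * S ^ 3) / (4 * S ^ 2) * (2 * S * cos (a / 2)) =
      cos (a / 2) ^ 2 * (1 - 8 * S ^ 3) / (4 * S ^ 2) * (2 * S) := by ring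
    rw [this, hc]
    field_simp
    ring
  have h2 : 0 < 8 * S ^ 3 + 2 - 9 * S ^ 2 + 6 * S ^ 4 := by
    nlinarith [sq_nonneg (S - 1 / 2), sq_nonneg (S ^ 2 - 1 / 4), mul_pos h h,
      mul_nonneg h.le (sq_nonneg (S - 1 / 2))]
  have : 0 < (8 * S ^ 3 + 2 - 9 * S ^ 2 + 6 * S ^ 4) / (8 * S ^ 3) := by positivity
  linarith

/-- The analogue for f(2a) / cos a; with S = sin a the difference contains the factors cos a, 1 - S²
and 1 + 4 S³, all nonnegative. -/
theorem force_two_mul_mul_sin_le {a : ℝ} (h0 : 0 < a) (h1 : a ≤ π / 2) :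
    force (2 * a) * sin a ≤ 2 * stiffness (2 * a) * cos a := by
  have e2 : 2 * a / 2 = a := by ring
  have h : 0 < sin (2 * a / 2) := sin_half_pos (by linarith) (by linarith)
  have hle := sin_le_one a
  have hc : 0 ≤ cos a := cos_nonneg_of_mem_Icc ⟨by linarith [pi_pos], h1⟩
  rw [force_eq_half h, stiffness_eq_half h]
  rw [e2] at *
  set S := sin a
  have e : 2 * ((8 * S ^ 3 - 16 * S ^ 5 + 2 - S ^ 2) / (8 * S ^ 3)) * cos a -
      cos a * (1 - 8 * S ^ 3) / (4 * S ^ 2) * S =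
      cos a * ((1 - S ^ 2) * (1 + 4 * S ^ 3)) / (2 * S ^ 3) := by
    field_simp
    ring
  have : 0 ≤ 1 - S ^ 2 := by nlinarith
  have : 0 ≤ cos a * ((1 - S ^ 2) * (1 + 4 * S ^ 3)) / (2 * S ^ 3) := by positivity
  linarith

/-! ### The inner angle as a function of the outer angle -/

section InnerEquilibrium

variable {p q s : ℝ}

/-- This is the numerator of the derivative of the inner force divided by cos a. Without the
division monotonicity can fail, as the stiffness at 2 a may be negative and q large. -/
theorem innerForce_deriv_pos (hp : 0 < p) (hq : 0 < q) (hs : 0 < s) {a b : ℝ} (ha : 0 < a)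
    (hab : a < b) (hb : b ≤ π / 2) :
    0 < (p * (stiffness (b - a) + stiffness (a + b)) +
          (s * stiffness a + 2 * q * stiffness (2 * a))) * cos a + innerForce p q s a b * sin a := by
  have hc : 0 < cos a := cos_pos_of_mem_Ioo ⟨by linarith [pi_pos], by linarith⟩
  have hsin : 0 < sin a := sin_pos_of_pos_of_lt_pi ha (by linarith [pi_pos])
  have h1 := mul_pos hs (sub_pos.2 (force_mul_sin_lt ha (by linarith [pi_pos])))
  have h2 := mul_nonneg hq.le (sub_nonneg.2 (force_two_mul_mul_sin_le ha (by linarith)))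
  have h3 := mul_pos (mul_pos hp (sub_pos.2 (force_lt_force (x := b - a) (y := a + b)
    (by linarith) (by linarith) (by linarith)))) hsin
  have h4 := mul_pos (mul_pos hp (stiffness_add_pos (x := b - a) (y := a + b)
    (by linarith) (by linarith) (by linarith))) hc
  rw [innerForce]
  linarith

theorem innerForce_div_cos_strictMonoOn (hp : 0 < p) (hq : 0 < q) (hs : 0 < s) {b : ℝ}
    (hb : b ≤ π / 2) :
    StrictMonoOn (fun a => innerForce p q s a b / cos a) (Set.Ioo 0 b) := by
  have hc : ∀ a ∈ Set.Ioo 0 b, 0 < cos a := fun a ha =>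
    cos_pos_of_mem_Ioo ⟨by linarith [pi_pos, ha.1], by linarith [ha.2]⟩
  have hd : ∀ a ∈ Set.Ioo 0 b, HasDerivAt (fun a => innerForce p q s a b / cos a) _ a :=
    fun a ha => (hasDerivAt_innerForce p q s ha.1 ha.2 hb).div (hasDerivAt_cos a) (hc a ha).ne'
  apply strictMonoOn_of_deriv_pos (convex_Ioo 0 b)
  · exact fun a ha => (hd a ha).continuousAt.continuousWithinAt
  · intro a ha
    rw [interior_Ioo] at ha
    rw [(hd a ha).deriv]
    have := innerForce_deriv_pos hp hq hs ha.1 ha.2 hb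
    apply div_pos _ (by have := hc a ha; positivity)
    linarith

theorem tendsto_force_nhdsGT_zero : Tendsto force (𝓝[>] 0) atTop := by
  have hs : Tendsto (fun x : ℝ => sin (x / 2)) (𝓝[>] 0) (𝓝[>] 0) := by
    apply tendsto_nhdsWithin_of_tendsto_nhds_of_eventually_within
    · have : ContinuousAt (fun x : ℝ => sin (x / 2)) 0 := by fun_prop
      simpa [ContinuousAt] using this.mono_left (nhdsWithin_le_nhds (s := Set.Ioi 0))
    · filter_upwards [Ioo_mem_nhdsGT pi_pos] with x hx
      exact sin_half_pos hx.1 hx.2.le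
  have h1 : Tendsto (fun x : ℝ => cos (x / 2) * (1 - 8 * sin (x / 2) ^ 3) / 4) (𝓝[>] 0)
      (𝓝 (1 / 4)) := by
    have : ContinuousAt (fun x : ℝ => cos (x / 2) * (1 - 8 * sin (x / 2) ^ 3) / 4) 0 := by fun_prop
    simpa [ContinuousAt] using this.mono_left (nhdsWithin_le_nhds (s := Set.Ioi 0))
  have h2 : Tendsto (fun x : ℝ => (sin (x / 2))⁻¹ ^ 2) (𝓝[>] 0) atTop :=
    (tendsto_pow_atTop two_ne_zero).comp (tendsto_inv_nhdsGT_zero.comp hs)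
  refine (h1.pos_mul_atTop (by norm_num) h2).congr' ?_
  filter_upwards [Ioo_mem_nhdsGT pi_pos] with x hx
  have := sin_half_pos hx.1 hx.2.le
  rw [force_eq_half this]
  field_simp

/-- The repulsion by the middle and the mirror point dominates as a → 0, that by the outer point as
a → b; the limits are -∞ and ∞. -/
theorem exists_innerForce_eq_zero (hp : 0 < p) (hq : 0 < q) (hs : 0 < s) {b : ℝ} (h0 : 0 < b)
    (hb : b ≤ π / 2) : ∃ a ∈ Set.Ioo 0 b, innerForce p q s a b = 0 := by
  have cf : ∀ {x : ℝ}, 0 < x → x ≤ π → ContinuousAt force x := fun hx0 hx =>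
    (hasDerivAt_force (sin_half_pos hx0 hx)).continuousAt
  have hpi := pi_pos
  have cont : ContinuousOn (fun a => innerForce p q s a b) (Set.Ioo 0 b) := fun a ha =>
    (hasDerivAt_innerForce p q s ha.1 ha.2 hb).continuousAt.continuousWithinAt
  have lim0 : Tendsto (fun a => innerForce p q s a b) (𝓝[>] 0) atBot := by
    have c1 : Tendsto (fun a => p * (force (b - a) - force (a + b))) (𝓝[>] 0)
        (𝓝 (p * (force (b - 0) - force (0 + b)))) := by
      apply Tendsto.mono_left _ nhdsWithin_le_nhds
      have k1 : ContinuousAt (fun a => force (b - a)) 0 :=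
        ContinuousAt.comp (f := fun a => b - a) (cf (by linarith) (by linarith)) (by fun_prop)
      have k2 : ContinuousAt (fun a => force (a + b)) 0 :=
        ContinuousAt.comp (f := fun a => a + b) (cf (by linarith) (by linarith)) (by fun_prop)
      exact (continuousAt_const.mul (k1.sub k2)).tendsto
    have t2 : Tendsto (fun a : ℝ => 2 * a) (𝓝[>] 0) (𝓝[>] 0) := by
      apply tendsto_nhdsWithin_of_tendsto_nhds_of_eventually_within
      · have : ContinuousAt (fun a : ℝ => 2 * a) 0 := by fun_prop
        simpa [ContinuousAt] using this.mono_left (nhdsWithin_le_nhds (s := Set.Ioi 0))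
      · filter_upwards [self_mem_nhdsWithin] with x hx
        exact mul_pos two_pos (Set.mem_Ioi.1 hx)
    have c2 := (tendsto_force_nhdsGT_zero.comp t2).const_mul_atTop hq
    have c3 := tendsto_force_nhdsGT_zero.const_mul_atTop hs
    have c4 := c1.add_atBot (tendsto_neg_atTop_atBot.comp (c2.atTop_add_atTop c3))
    refine c4.congr fun a => ?_
    simp only [innerForce, Function.comp_apply]
    ring
  have limb : Tendsto (fun a => innerForce p q s a b) (𝓝[<] b) atTop := by
    have t1 : Tendsto (fun a : ℝ => b - a) (𝓝[<] b) (𝓝[>] 0) := by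
      apply tendsto_nhdsWithin_of_tendsto_nhds_of_eventually_within
      · have : ContinuousAt (fun a : ℝ => b - a) b := by fun_prop
        simpa [ContinuousAt] using this.mono_left (nhdsWithin_le_nhds (s := Set.Iio b))
      · filter_upwards [self_mem_nhdsWithin] with x hx
        exact sub_pos.2 (Set.mem_Iio.1 hx)
    have c1 := (tendsto_force_nhdsGT_zero.comp t1).const_mul_atTop hp
    have c2 : Tendsto (fun a => -(p * force (a + b)) - q * force (2 * a) - s * force a) (𝓝[<] b)
        (𝓝 (-(p * force (b + b)) - q * force (2 * b) - s * force b)) := by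
      apply Tendsto.mono_left _ nhdsWithin_le_nhds
      have k1 : ContinuousAt (fun a => force (a + b)) b :=
        ContinuousAt.comp (f := fun a => a + b) (cf (by linarith) (by linarith)) (by fun_prop)
      have k2 : ContinuousAt (fun a => force (2 * a)) b :=
        ContinuousAt.comp (f := fun a => 2 * a) (cf (by linarith) (by linarith)) (by fun_prop)
      have k3 : ContinuousAt force b := cf h0 (by linarith)
      exact (((continuousAt_const.mul k1).neg.sub (continuousAt_const.mul k2)).sub
        (continuousAt_const.mul k3)).tendsto
    refine (c1.atTop_add c2).congr fun a => ?_
    simp only [innerForce, Function.comp_apply]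
    ring
  obtain ⟨x, hx0, hx⟩ := ((lim0.eventually_lt_atBot 0).and (Ioo_mem_nhdsGT h0)).exists
  obtain ⟨y, hy0, hy⟩ := ((limb.eventually_gt_atTop 0).and (Ioo_mem_nhdsLT h0)).exists
  have := isPreconnected_Ioo.intermediate_value hx hy cont
  obtain ⟨a, ha, ha0⟩ := this ⟨hx0.le, hy0.le⟩
  exact ⟨a, ha, ha0⟩

/-- The unique inner angle `a` at which the inner force vanishes, for a given outer angle. -/
noncomputable def innerAngle (p q s b : ℝ) : ℝ :=
  Classical.epsilon fun a => a ∈ Set.Ioo 0 b ∧ innerForce p q s a b = 0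

theorem innerAngle_spec (hp : 0 < p) (hq : 0 < q) (hs : 0 < s) {b : ℝ} (h0 : 0 < b)
    (hb : b ≤ π / 2) :
    innerAngle p q s b ∈ Set.Ioo 0 b ∧ innerForce p q s (innerAngle p q s b) b = 0 := by
  obtain ⟨a, h1, h2⟩ := exists_innerForce_eq_zero hp hq hs h0 hb
  exact Classical.epsilon_spec (p := fun a => a ∈ Set.Ioo 0 b ∧ innerForce p q s a b = 0)
    ⟨a, h1, h2⟩

theorem innerForce_neg_of_lt (hp : 0 < p) (hq : 0 < q) (hs : 0 < s) {a b : ℝ}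
    (ha : 0 < a) (hb : b ≤ π / 2) (h0 : 0 < b) (h : a < innerAngle p q s b) :
    innerForce p q s a b < 0 := by
  obtain ⟨h1, h2⟩ := innerAngle_spec hp hq hs h0 hb
  have := innerForce_div_cos_strictMonoOn hp hq hs hb ⟨ha, h.trans h1.2⟩ h1 h
  simp only [h2, zero_div] at this
  have hc : 0 < cos a := cos_pos_of_mem_Ioo ⟨by linarith [pi_pos], by linarith [h1.2]⟩
  exact not_le.1 fun hle => absurd (div_nonneg hle hc.le) (not_le.2 this)

theorem innerForce_pos_of_lt (hp : 0 < p) (hq : 0 < q) (hs : 0 < s) {a b : ℝ}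
    (h0 : 0 < b) (hab : a < b) (hb : b ≤ π / 2) (h : innerAngle p q s b < a) :
    0 < innerForce p q s a b := by
  obtain ⟨h1, h2⟩ := innerAngle_spec hp hq hs h0 hb
  have := innerForce_div_cos_strictMonoOn hp hq hs hb h1 ⟨h1.1.trans h, hab⟩ h
  simp only [h2, zero_div] at this
  have hc : 0 < cos a := cos_pos_of_mem_Ioo ⟨by linarith [pi_pos, h1.1], by linarith⟩
  exact (div_pos_iff_of_pos_right hc).1 this

theorem eq_innerAngle (hp : 0 < p) (hq : 0 < q) (hs : 0 < s) {a b : ℝ} (ha : 0 < a)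
    (hab : a < b) (hb : b ≤ π / 2) (h : innerForce p q s a b = 0) : a = innerAngle p q s b := by
  rcases lt_trichotomy a (innerAngle p q s b) with h1 | h1 | h1
  · exact absurd h (innerForce_neg_of_lt hp hq hs ha hb (ha.trans hab) h1).ne
  · exact h1
  · exact absurd h (innerForce_pos_of_lt hp hq hs (ha.trans hab) hab hb h1).ne'

/-- For a fixed angle on either side of the root, the sign of the inner force persists for nearby b,
and this sign tells on which side the root lies. -/
theorem continuousOn_innerAngle (hp : 0 < p) (hq : 0 < q) (hs : 0 < s) :
    ContinuousOn (innerAngle p q s) (Set.Ioc 0 (π / 2)) := by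
  intro b₀ hb₀
  obtain ⟨h1, h2⟩ := innerAngle_spec hp hq hs hb₀.1 hb₀.2
  have cont : ∀ a, 0 < a → a < b₀ → ContinuousAt (fun b => innerForce p q s a b) b₀ := by
    intro a ha hab
    exact ContinuousAt.comp (f := fun b => (a, b)) (g := fun z : ℝ × ℝ => innerForce p q s z.1 z.2)
      (hasFDerivAt_innerForce p q s ha hab hb₀.2).continuousAt (by fun_prop)
  rw [ContinuousWithinAt, tendsto_order]
  constructor
  · intro a' ha'
    obtain ⟨a, ha1, ha2⟩ := exists_between (max_lt ha' h1.1)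
    have ha0 : 0 < a := (le_max_right _ _).trans_lt ha1
    have hneg := innerForce_neg_of_lt hp hq hs ha0 hb₀.2 hb₀.1 ha2
    have ev := (cont a ha0 (ha2.trans h1.2)).eventually (gt_mem_nhds hneg)
    have ev2 := lt_mem_nhds (ha2.trans h1.2)
    filter_upwards [nhdsWithin_le_nhds ev, nhdsWithin_le_nhds ev2, self_mem_nhdsWithin]
      with b e1 e2 e3
    refine ((le_max_left _ _).trans_lt ha1).trans_le ?_
    by_contra hlt
    exact absurd (innerForce_pos_of_lt hp hq hs e3.1 e2 e3.2 (not_le.1 hlt)) (not_lt.2 e1.le)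
  · intro a' ha'
    obtain ⟨a, ha1, ha2⟩ := exists_between (lt_min ha' h1.2)
    have hab : a < b₀ := ha2.trans_le (min_le_right _ _)
    have ha0 : 0 < a := h1.1.trans ha1
    have hpos := innerForce_pos_of_lt hp hq hs hb₀.1 hab hb₀.2 ha1
    have ev := (cont a ha0 hab).eventually (lt_mem_nhds hpos)
    filter_upwards [nhdsWithin_le_nhds ev, self_mem_nhdsWithin] with b e1 e3
    refine lt_of_le_of_lt ?_ (ha2.trans_le (min_le_left _ _))
    by_contra hlt
    exact absurd (innerForce_neg_of_lt hp hq hs ha0 e3.2 e3.1 (not_le.1 hlt)) (not_lt.2 e1.le)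

end InnerEquilibrium

/-! ### Uniqueness of the reduced equilibrium -/

theorem ReducedEquilibrium.innerForce_eq_zero {p q s a b : ℝ} (h : ReducedEquilibrium p q s a b) :
    innerForce p q s a b = 0 := by
  rw [innerForce]; linear_combination -h.inner

theorem ReducedEquilibrium.outerForce_eq_zero {p q s a b : ℝ} (h : ReducedEquilibrium p q s a b) :
    outerForce p q s a b = 0 := by
  rw [outerForce]; linear_combination -h.outer

theorem ReducedEquilibrium.innerStiffness_pos {p q s a b : ℝ} (h : ReducedEquilibrium p q s a b)
    (hp : 0 < p) (hq : 0 < q) (hs : 0 < s) (ha : 0 < a) (hab : a < b) (hb : b ≤ π / 2) :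
    0 < p * (stiffness (b - a) + stiffness (a + b)) +
          (s * stiffness a + 2 * q * stiffness (2 * a)) := by
  have h1 := innerForce_deriv_pos hp hq hs ha hab hb
  rw [h.innerForce_eq_zero, zero_mul, add_zero] at h1
  exact pos_of_mul_pos_left h1 (cos_nonneg_of_mem_Icc ⟨by linarith [pi_pos], by linarith⟩)

/-- Both equilibria lie on the curve of inner equilibria, and would give two zeros of the outer
force along it, all of whose zeros are upward crossings. -/
theorem reducedEquilibrium_outer_not_lt {p q s a₁ b₁ a₂ b₂ : ℝ} (hp : 0 < p) (hq : 0 < q)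
    (hs : 0 < s) (ha₁ : 0 < a₁) (hab₁ : a₁ < b₁) (h₁ : ReducedEquilibrium p q s a₁ b₁)
    (ha₂ : 0 < a₂) (hab₂ : a₂ < b₂) (hb₂ : b₂ ≤ π / 2) (h₂ : ReducedEquilibrium p q s a₂ b₂) :
    ¬ b₁ < b₂ := by
  intro hlt
  have hsub : Set.Icc b₁ b₂ ⊆ Set.Ioc 0 (π / 2) := fun b hb =>
    ⟨(ha₁.trans hab₁).trans_le hb.1, hb.2.trans hb₂⟩
  have e₁ := eq_innerAngle hp hq hs ha₁ hab₁ (hlt.le.trans hb₂) h₁.innerForce_eq_zero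
  have e₂ := eq_innerAngle hp hq hs ha₂ hab₂ hb₂ h₂.innerForce_eq_zero
  have hA : ContinuousOn (fun b => (innerAngle p q s b, b)) (Set.Icc b₁ b₂) :=
    ((continuousOn_innerAngle hp hq hs).mono hsub).prodMk continuousOn_id
  refine not_two_upcrossings (h := fun b => outerForce p q s (innerAngle p q s b) b) hlt ?_ ?_ ?_ ?_
  · intro b hb
    obtain ⟨k1, k2⟩ := innerAngle_spec hp hq hs (hsub hb).1 (hsub hb).2
    exact ContinuousAt.comp_continuousWithinAt (f := fun b => (innerAngle p q s b, b))
      (g := fun z : ℝ × ℝ => outerForce p q s z.1 z.2)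
      (hasFDerivAt_outerForce p q s k1.1 k1.2 (hsub hb).2).continuousAt (hA b hb)
  · simp only [← e₁, h₁.outerForce_eq_zero]
  · simp only [← e₂, h₂.outerForce_eq_zero]
  · intro b hb h0
    obtain ⟨k1, k2⟩ := innerAngle_spec hp hq hs (hsub hb).1 (hsub hb).2
    have he : ReducedEquilibrium p q s (innerAngle p q s b) b := by
      constructor
      · rw [outerForce] at h0; linarith
      · rw [innerForce] at k2; linarith
    have hdet := hessianDet_pos hp hq hs k1.1 k1.2 (hsub hb).2 he
    have ev := eventually_sign_of_jacobian_pos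
      (hasFDerivAt_innerForce p q s k1.1 k1.2 (hsub hb).2)
      (hasFDerivAt_outerForce p q s k1.1 k1.2 (hsub hb).2) k2 h0
      (he.innerStiffness_pos hp hq hs k1.1 k1.2 (hsub hb).2)
      (by rw [hessianDet] at hdet; linarith)
    filter_upwards [(hA b hb).eventually ev, self_mem_nhdsWithin] with c hc hcI
    exact hc (innerAngle_spec hp hq hs (hsub hcI).1 (hsub hcI).2).2

/-- The symmetric configurations in equilibrium for given masses are unique. -/
theorem reducedEquilibrium_unique {p q s a₁ b₁ a₂ b₂ : ℝ} (hp : 0 < p) (hq : 0 < q)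
    (hs : 0 < s) (ha₁ : 0 < a₁) (hab₁ : a₁ < b₁) (hb₁ : b₁ ≤ π / 2)
    (h₁ : ReducedEquilibrium p q s a₁ b₁)
    (ha₂ : 0 < a₂) (hab₂ : a₂ < b₂) (hb₂ : b₂ ≤ π / 2) (h₂ : ReducedEquilibrium p q s a₂ b₂) :
    a₁ = a₂ ∧ b₁ = b₂ := by
  have hb : b₁ = b₂ := le_antisymm
    (not_lt.1 (reducedEquilibrium_outer_not_lt hp hq hs ha₂ hab₂ h₂ ha₁ hab₁ hb₁ h₁))
    (not_lt.1 (reducedEquilibrium_outer_not_lt hp hq hs ha₁ hab₁ h₁ ha₂ hab₂ hb₂ h₂))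
  subst hb
  exact ⟨(eq_innerAngle hp hq hs ha₁ hab₁ hb₁ h₁.innerForce_eq_zero).trans
    (eq_innerAngle hp hq hs ha₂ hab₂ hb₂ h₂.innerForce_eq_zero).symm, rfl⟩

/-! ### Second order analysis of the potential -/

theorem potential_eq_sum_pairPotential {N : ℕ} (m θ : Fin N → ℝ) :
    potential m θ = ∑ i, ∑ j ∈ Finset.Ioi i, m i * m j * pairPotential (θ i - θ j) := rfl

/-- The Hessian quadratic form of the potential. -/
noncomputable def hessianForm {N : ℕ} (m θ v : Fin N → ℝ) : ℝ :=
  ∑ i, ∑ j ∈ Finset.Ioi i, m i * m j * stiffness (θ i - θ j) * (v i - v j) ^ 2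

theorem iteratedDeriv_two_potential {N : ℕ} (m θ v : Fin N → ℝ)
    (h : ∀ i, ∀ j ∈ Finset.Ioi i, 0 < sin ((θ i - θ j) / 2)) :
    iteratedDeriv 2 (fun t : ℝ => potential m (θ + t • v)) 0 = hessianForm m θ v := by
  have hlin : ∀ (i j : Fin N) (t : ℝ),
      HasDerivAt (fun t => (θ + t • v) i - (θ + t • v) j) (v i - v j) t := by
    intro i j t
    have h1 : HasDerivAt (fun t : ℝ => θ i - θ j + t * (v i - v j)) (v i - v j) t := by
      simpa using ((hasDerivAt_id t).mul_const (v i - v j)).const_add (θ i - θ j)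
    refine h1.congr_of_eventuallyEq (Eventually.of_forall fun t => ?_)
    simp only [Pi.add_apply, Pi.smul_apply, smul_eq_mul]
    ring
  have hev : ∀ᶠ t : ℝ in 𝓝 0, ∀ i, ∀ j ∈ Finset.Ioi i,
      0 < sin (((θ + t • v) i - (θ + t • v) j) / 2) := by
    rw [eventually_all]
    intro i
    rw [Filter.eventually_all_finset]
    intro j hj
    refine (hlin i j 0).continuousAt.eventually (p := fun x => 0 < sin (x / 2))
      (eventually_sin_half_pos ?_)
    simpa using h i j hj
  have hd1 : deriv (fun t : ℝ => potential m (θ + t • v)) =ᶠ[𝓝 0] fun t =>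
      ∑ i, ∑ j ∈ Finset.Ioi i,
        m i * m j * (-force ((θ + t • v) i - (θ + t • v) j) * (v i - v j)) := by
    filter_upwards [hev] with t ht
    apply HasDerivAt.deriv
    simp only [potential_eq_sum_pairPotential]
    refine HasDerivAt.fun_sum fun i _ => HasDerivAt.fun_sum fun j hj => ?_
    exact ((hasDerivAt_pairPotential (ht i j hj)).comp t (hlin i j t)).const_mul _
  rw [iteratedDeriv_succ, iteratedDeriv_one, hd1.deriv_eq]
  apply HasDerivAt.deriv
  refine HasDerivAt.fun_sum fun i _ => HasDerivAt.fun_sum fun j hj => ?_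
  have h0 : 0 < sin (((θ + (0 : ℝ) • v) i - (θ + (0 : ℝ) • v) j) / 2) := by simpa using h i j hj
  have := ((((hasDerivAt_force h0).comp 0 (hlin i j 0)).neg).mul_const (v i - v j)).const_mul
    (m i * m j)
  refine this.congr_deriv ?_
  simp only [zero_smul, add_zero]
  ring

/-- Subtracting the Taylor polynomial with second derivative lowered by ε leaves a function with
vanishing first and positive second derivative at x. -/
theorem eventually_pairPotential_ge {x ε : ℝ} (h : 0 < sin (x / 2)) (hε : 0 < ε) :
    ∀ᶠ y in 𝓝 x, pairPotential x - force x * (y - x) + (stiffness x - ε) / 2 * (y - x) ^ 2 ≤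
      pairPotential y := by
  set g : ℝ → ℝ := fun y =>
    pairPotential y + force x * (y - x) - (stiffness x - ε) / 2 * (y - x) ^ 2 with hg
  have hd : ∀ y, 0 < sin (y / 2) →
      HasDerivAt g (-force y + force x - (stiffness x - ε) * (y - x)) y := by
    intro y hy
    have h1 := (hasDerivAt_id y).sub_const x
    refine (((hasDerivAt_pairPotential hy).add (h1.const_mul (force x))).sub
      ((h1.pow 2).const_mul ((stiffness x - ε) / 2))).congr_deriv ?_
    simp
    ring
  have hd1 : deriv g =ᶠ[𝓝 x] fun y => -force y + force x - (stiffness x - ε) * (y - x) := by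
    filter_upwards [eventually_sin_half_pos h] with y hy
    exact (hd y hy).deriv
  have hd2 : HasDerivAt (fun y => -force y + force x - (stiffness x - ε) * (y - x)) ε x := by
    refine (((hasDerivAt_force h).neg.add_const (force x)).sub
      (((hasDerivAt_id x).sub_const x).const_mul (stiffness x - ε))).congr_deriv ?_
    simp
  have hmin : IsLocalMin g x := by
    apply isLocalMin_of_deriv_deriv_pos
    · rw [hd1.deriv_eq, hd2.deriv]; exact hε
    · rw [(hd x h).deriv]; ring
    · exact (hd x h).continuousAt
  filter_upwards [hmin] with y hy
  simp only [hg, sub_self, mul_zero, add_zero] at hy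
  linarith

/-- The lower bounds for the pairs are summed; the linear part vanishes by criticality. Only
differences of angles enter, so the degenerate direction of rotations causes no trouble. -/
theorem isLocalMin_potential {N : ℕ} {m θ : Fin N → ℝ} (hm : ∀ i, 0 < m i)
    (h : ∀ i, ∀ j ∈ Finset.Ioi i, 0 < sin ((θ i - θ j) / 2))
    (hcrit : ∀ v : Fin N → ℝ,
      ∑ i, ∑ j ∈ Finset.Ioi i, m i * m j * (force (θ i - θ j) * (v i - v j)) = 0)
    {ε : ℝ} (hε : 0 < ε) (hform : ∀ v : Fin N → ℝ,
      0 ≤ ∑ i, ∑ j ∈ Finset.Ioi i, m i * m j * (stiffness (θ i - θ j) - ε) * (v i - v j) ^ 2) :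
    IsLocalMin (potential m) θ := by
  have hev : ∀ᶠ θ' : Fin N → ℝ in 𝓝 θ, ∀ i, ∀ j ∈ Finset.Ioi i,
      pairPotential (θ i - θ j) - force (θ i - θ j) * ((θ' i - θ' j) - (θ i - θ j)) +
        (stiffness (θ i - θ j) - ε) / 2 * ((θ' i - θ' j) - (θ i - θ j)) ^ 2 ≤
      pairPotential (θ' i - θ' j) := by
    rw [eventually_all]
    intro i
    rw [Filter.eventually_all_finset]
    intro j hj
    have hc : ContinuousAt (fun θ' : Fin N → ℝ => θ' i - θ' j) θ := by fun_prop
    exact hc.eventually (eventually_pairPotential_ge (h i j hj) hε)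
  filter_upwards [hev] with θ' hθ'
  have h1 := hcrit (θ' - θ)
  have h2 := hform (θ' - θ)
  have h3 : ∑ i, ∑ j ∈ Finset.Ioi i, m i * m j *
      (pairPotential (θ i - θ j) - force (θ i - θ j) * ((θ' i - θ' j) - (θ i - θ j)) +
        (stiffness (θ i - θ j) - ε) / 2 * ((θ' i - θ' j) - (θ i - θ j)) ^ 2) ≤ potential m θ' := by
    rw [potential_eq_sum_pairPotential]
    refine Finset.sum_le_sum fun i _ => Finset.sum_le_sum fun j hj => ?_
    exact mul_le_mul_of_nonneg_left (hθ' i j hj) (mul_pos (hm i) (hm j)).le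
  have h4 : ∑ i, ∑ j ∈ Finset.Ioi i, m i * m j *
      (pairPotential (θ i - θ j) - force (θ i - θ j) * ((θ' i - θ' j) - (θ i - θ j)) +
        (stiffness (θ i - θ j) - ε) / 2 * ((θ' i - θ' j) - (θ i - θ j)) ^ 2) =
      potential m θ - ∑ i, ∑ j ∈ Finset.Ioi i,
          m i * m j * (force (θ i - θ j) * ((θ' - θ) i - (θ' - θ) j)) +
        (∑ i, ∑ j ∈ Finset.Ioi i,
          m i * m j * (stiffness (θ i - θ j) - ε) * ((θ' - θ) i - (θ' - θ) j) ^ 2) / 2 := by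
    rw [potential_eq_sum_pairPotential, Finset.sum_div, ← Finset.sum_sub_distrib,
      ← Finset.sum_add_distrib]
    refine Finset.sum_congr rfl fun i _ => ?_
    rw [Finset.sum_div, ← Finset.sum_sub_distrib, ← Finset.sum_add_distrib]
    refine Finset.sum_congr rfl fun j _ => ?_
    simp only [Pi.sub_apply]
    ring
  rw [h1] at h4
  show potential m θ ≤ potential m θ'
  linarith

/-! ### Symmetric configurations of five points -/

theorem sum_pairs_fin_five (g : Fin 5 → Fin 5 → ℝ) :
    ∑ i, ∑ j ∈ Finset.Ioi i, g i j =
      g 0 1 + g 0 2 + g 0 3 + g 0 4 + g 1 2 + g 1 3 + g 1 4 + g 2 3 + g 2 4 + g 3 4 := by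
  have h0 : Finset.Ioi (0 : Fin 5) = {1, 2, 3, 4} := by decide
  have h1 : Finset.Ioi (1 : Fin 5) = {2, 3, 4} := by decide
  have h2 : Finset.Ioi (2 : Fin 5) = {3, 4} := by decide
  have h3 : Finset.Ioi (3 : Fin 5) = {4} := by decide
  have h4 : Finset.Ioi (4 : Fin 5) = ∅ := by decide
  rw [Fin.sum_univ_five, h0, h1, h2, h3, h4]
  simp only [Finset.sum_singleton, Finset.sum_empty]
  repeat rw [Finset.sum_insert (by decide)]
  simp only [Finset.sum_singleton]
  ring

/-- The Hessian quadratic form of a configuration `b, a, 0, -a, -b` with masses `p, q, s, q, p`,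
as a function of the stiffnesses at the angular differences `b - a`, `a + b`, `a`, `b`, `2 a`
and `2 b`. -/
def symmetricForm (p q s um up ua ub u2a u2b : ℝ) (v : Fin 5 → ℝ) : ℝ :=
  p * q * um * ((v 0 - v 1) ^ 2 + (v 3 - v 4) ^ 2) +
    p * q * up * ((v 0 - v 3) ^ 2 + (v 1 - v 4) ^ 2) +
    p * s * ub * ((v 0 - v 2) ^ 2 + (v 2 - v 4) ^ 2) +
    q * s * ua * ((v 1 - v 2) ^ 2 + (v 2 - v 3) ^ 2) +
    p * p * u2b * (v 0 - v 4) ^ 2 + q * q * u2a * (v 1 - v 3) ^ 2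

/-- A symmetric form splits into its restrictions to the symmetric and to the antisymmetric
variations; the former is positive by its determinant. -/
theorem symmetricForm_pos {p q s um up ua ub u2a u2b : ℝ} (hp : 0 < p) (hq : 0 < q) (hs : 0 < s)
    (hu : 0 < um + up) (hua : 0 < ua) (hub : 0 < ub)
    (hI : 0 < p * (um + up) + (s * ua + 2 * q * u2a))
    (hdet : 0 < hessianDet p q s um up ua ub u2a u2b) {v : Fin 5 → ℝ}
    (hv : ¬ ∃ c, ∀ i, v i = c) : 0 < symmetricForm p q s um up ua ub u2a u2b v := by
  -- The variations β, α change the angles b, a and keep the mirror symmetry; ξ, η move mirror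
  -- points together, relative to the middle point.
  set β := (v 0 - v 4) / 2 with hβ
  set α := (v 1 - v 3) / 2 with hα
  set ξ := (v 0 + v 4) / 2 - v 2 with hξ
  set η := (v 1 + v 3) / 2 - v 2 with hη
  set I := p * (um + up) + (s * ua + 2 * q * u2a) with hIdef
  -- The first block is a completed square in α with pivot I, which leaves the determinant as
  -- coefficient of β².
  have e : symmetricForm p q s um up ua ub u2a u2b v =
      2 * ((q * (I * α + p * (up - um) * β) ^ 2 +
        p * hessianDet p q s um up ua ub u2a u2b * β ^ 2) / I) +
      2 * (p * q * (um + up) * (ξ - η) ^ 2 + p * s * ub * ξ ^ 2 + q * s * ua * η ^ 2) := by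
    have e1 : (q * (I * α + p * (up - um) * β) ^ 2 +
        p * hessianDet p q s um up ua ub u2a u2b * β ^ 2) / I =
        q * I * α ^ 2 + 2 * p * q * (up - um) * α * β +
          p * (q * (um + up) + (s * ub + 2 * p * u2b)) * β ^ 2 := by
      rw [div_eq_iff hI.ne', hessianDet, ← hIdef]
      ring
    rw [e1, symmetricForm, hIdef, hβ, hα, hξ, hη]
    ring
  rw [e]
  have hne : ¬ (α = 0 ∧ β = 0 ∧ ξ = 0 ∧ η = 0) := by
    rintro ⟨h1, h2, h3, h4⟩
    apply hv
    refine ⟨v 2, fun i => ?_⟩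
    fin_cases i <;> simp only [Fin.zero_eta, Fin.mk_one, Fin.reduceFinMk] <;> linarith
  by_cases hβ0 : β = 0
  · by_cases hα0 : α = 0
    · rw [hβ0, hα0]
      by_cases hξ0 : ξ = 0
      · have hη0 : η ≠ 0 := fun h => hne ⟨hα0, hβ0, hξ0, h⟩
        positivity
      · positivity
    · rw [hβ0]
      have : 0 < q * (I * α + p * (up - um) * 0) ^ 2 := by
        rw [mul_zero, add_zero]; positivity
      positivity
  · positivity

theorem symmetricForm_nonneg {p q s um up ua ub u2a u2b : ℝ} (hp : 0 < p) (hq : 0 < q)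
    (hs : 0 < s) (hu : 0 < um + up) (hua : 0 < ua) (hub : 0 < ub)
    (hI : 0 < p * (um + up) + (s * ua + 2 * q * u2a))
    (hdet : 0 < hessianDet p q s um up ua ub u2a u2b) (v : Fin 5 → ℝ) :
    0 ≤ symmetricForm p q s um up ua ub u2a u2b v := by
  by_cases hv : ∃ c, ∀ i, v i = c
  · obtain ⟨c, hc⟩ := hv
    simp [symmetricForm, hc]
  · exact (symmetricForm_pos hp hq hs hu hua hub hI hdet hv).le

/-- A convex symmetric configuration is `b, a, 0, -a, -b` up to rotation. -/
theorem IsConvexSymmetric.exists_angles {θ : Fin 5 → ℝ} (h : IsConvexSymmetric θ) :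
    ∃ a b, 0 < a ∧ a < b ∧ b ≤ π / 2 ∧ θ 0 = θ 2 + b ∧ θ 1 = θ 2 + a ∧ θ 3 = θ 2 - a ∧
      θ 4 = θ 2 - b := by
  have h0 := h.symmetric 0
  have h1 := h.symmetric 1
  have r0 : (0 : Fin 5).rev = 4 := by decide
  have r1 : (1 : Fin 5).rev = 3 := by decide
  rw [r0] at h0
  rw [r1] at h1
  have o1 : θ 1 < θ 0 := h.ordered (by decide)
  have o2 : θ 2 < θ 1 := h.ordered (by decide)
  have hc := h.convex
  exact ⟨θ 1 - θ 2, θ 0 - θ 2, by linarith, by linarith, by linarith, by ring, by ring,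
    by linarith, by linarith⟩

theorem IsConvexSymmetric.sin_half_sub_pos {θ : Fin 5 → ℝ} (h : IsConvexSymmetric θ) :
    ∀ i, ∀ j ∈ Finset.Ioi i, 0 < sin ((θ i - θ j) / 2) := by
  intro i j hij
  have h1 := h.ordered (Finset.mem_Ioi.1 hij)
  have h2 := h.ordered.antitone (Fin.zero_le i)
  have h3 := h.ordered.antitone (Fin.le_last j)
  have e : Fin.last 4 = 4 := rfl
  rw [e] at h3
  exact sin_half_pos (by linarith) (by linarith [h.convex])

theorem IsCentralConfiguration.sum_force {N : ℕ} {m θ : Fin N → ℝ}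
    (h : IsCentralConfiguration m θ) (i : Fin N) : ∑ j, force (θ i - θ j) * m j = 0 := by
  simpa [Matrix.mulVec, dotProduct, massMatrix] using congrFun h.2 i

/-- A symmetric central configuration is in equilibrium for the symmetrized masses. -/
theorem IsCentralConfiguration.reducedEquilibrium {m θ : Fin 5 → ℝ}
    (h : IsCentralConfiguration m θ) {a b : ℝ} (h0 : θ 0 = θ 2 + b) (h1 : θ 1 = θ 2 + a)
    (h3 : θ 3 = θ 2 - a) (h4 : θ 4 = θ 2 - b) :
    ReducedEquilibrium ((m 0 + m 4) / 2) ((m 1 + m 3) / 2) (m 2) a b := by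
  have e0 := h.sum_force 0
  have e1 := h.sum_force 1
  have e3 := h.sum_force 3
  have e4 := h.sum_force 4
  rw [Fin.sum_univ_five] at e0 e1 e3 e4
  have d : ∀ i j x, θ i - θ j = x → force (θ i - θ j) = force x ∧
      force (θ j - θ i) = -force x := by
    intro i j x hx
    rw [← neg_sub (θ i), hx, force_neg]
    exact ⟨rfl, rfl⟩
  have d01 := d 0 1 (b - a) (by rw [h0, h1]; ring)
  have d02 := d 0 2 b (by rw [h0]; ring)
  have d03 := d 0 3 (a + b) (by rw [h0, h3]; ring)
  have d04 := d 0 4 (2 * b) (by rw [h0, h4]; ring)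
  have d12 := d 1 2 a (by rw [h1]; ring)
  have d13 := d 1 3 (2 * a) (by rw [h1, h3]; ring)
  have d14 := d 1 4 (a + b) (by rw [h1, h4]; ring)
  have d23 := d 2 3 a (by rw [h3]; ring)
  have d24 := d 2 4 b (by rw [h4]; ring)
  have d34 := d 3 4 (b - a) (by rw [h3, h4]; ring)
  simp only [sub_self, force_zero, d01.1, d01.2, d02.1, d03.1, d03.2, d04.1, d04.2, d12.1,
    d13.1, d13.2, d14.1, d14.2, d23.2, d24.2, d34.1, d34.2] at e0 e1 e3 e4
  constructor
  -- Mirror points feel opposite forces, so half the difference of their equations replaces each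
  -- mass by the mean of a mirror pair.
  · linear_combination (e0 - e4) / 2
  · linear_combination (e1 - e3) / 2

theorem IsCentralConfiguration.sum_force_mul_eq_zero {m θ : Fin 5 → ℝ}
    (h : IsCentralConfiguration m θ) (v : Fin 5 → ℝ) :
    ∑ i, ∑ j ∈ Finset.Ioi i, m i * m j * (force (θ i - θ j) * (v i - v j)) = 0 := by
  have e := fun i => h.sum_force i
  simp only [Fin.sum_univ_five] at e
  have e0 := e 0
  have e1 := e 1
  have e2 := e 2
  have e3 := e 3
  have e4 := e 4
  have d : ∀ i j, force (θ j - θ i) = -force (θ i - θ j) := by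
    intro i j
    rw [← neg_sub (θ i), force_neg]
  simp only [sub_self, force_zero, d 0 1, d 0 2, d 0 3, d 0 4, d 1 2, d 1 3, d 1 4, d 2 3, d 2 4,
    d 3 4] at e0 e1 e2 e3 e4
  rw [sum_pairs_fin_five]
  linear_combination m 0 * v 0 * e0 + m 1 * v 1 * e1 + m 2 * v 2 * e2 + m 3 * v 3 * e3 +
    m 4 * v 4 * e4

theorem sum_stiffness_eq_symmetricForm {m θ : Fin 5 → ℝ} {a b : ℝ} (m4 : m 0 = m 4)
    (m3 : m 1 = m 3) (h0 : θ 0 = θ 2 + b) (h1 : θ 1 = θ 2 + a)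
    (h3 : θ 3 = θ 2 - a) (h4 : θ 4 = θ 2 - b) (ε : ℝ) (v : Fin 5 → ℝ) :
    ∑ i, ∑ j ∈ Finset.Ioi i, m i * m j * (stiffness (θ i - θ j) - ε) * (v i - v j) ^ 2 =
      symmetricForm (m 0) (m 1) (m 2) (stiffness (b - a) - ε) (stiffness (a + b) - ε)
        (stiffness a - ε) (stiffness b - ε) (stiffness (2 * a) - ε) (stiffness (2 * b) - ε) v := by
  rw [sum_pairs_fin_five, symmetricForm, ← m4, ← m3]
  have d01 : θ 0 - θ 1 = b - a := by rw [h0, h1]; ring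
  have d02 : θ 0 - θ 2 = b := by rw [h0]; ring
  have d03 : θ 0 - θ 3 = a + b := by rw [h0, h3]; ring
  have d04 : θ 0 - θ 4 = 2 * b := by rw [h0, h4]; ring
  have d12 : θ 1 - θ 2 = a := by rw [h1]; ring
  have d13 : θ 1 - θ 3 = 2 * a := by rw [h1, h3]; ring
  have d14 : θ 1 - θ 4 = a + b := by rw [h1, h4]; ring
  have d23 : θ 2 - θ 3 = a := by rw [h3]; ring
  have d24 : θ 2 - θ 4 = b := by rw [h4]; ring
  have d34 : θ 3 - θ 4 = b - a := by rw [h3, h4]; ring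
  rw [d01, d02, d03, d04, d12, d13, d14, d23, d24, d34]
  ring

theorem isNondegenerateMin_of_isConvexSymmetric {m θ : Fin 5 → ℝ} (hm : ∀ i, 0 < m i)
    (m4 : m 0 = m 4) (m3 : m 1 = m 3) (hθ : IsConvexSymmetric θ)
    (hcc : IsCentralConfiguration m θ) : IsNondegenerateMin m θ := by
  obtain ⟨a, b, ha, hab, hb, h0, h1, h3, h4⟩ := hθ.exists_angles
  have he := hcc.reducedEquilibrium h0 h1 h3 h4
  rw [← m4, ← m3, add_self_div_two, add_self_div_two] at he
  have hp := hm 0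
  have hq := hm 1
  have hs := hm 2
  have c1 := stiffness_add_pos (x := b - a) (y := a + b) (by linarith) (by linarith) (by linarith)
  have c2 := stiffness_pos ha (by linarith)
  have c3 := stiffness_pos (ha.trans hab) hb
  have c4 := he.innerStiffness_pos hp hq hs ha hab hb
  have c5 := hessianDet_pos hp hq hs ha hab hb he
  have hform := sum_stiffness_eq_symmetricForm m4 m3 h0 h1 h3 h4
  constructor
  -- All positivity conditions are strict and continuous in the stiffnesses, so they survive
  -- lowering every stiffness by a small ε > 0, the reserve needed for the second order comparison.
  · have hev : ∀ᶠ ε : ℝ in 𝓝 0,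
        0 < (stiffness (b - a) - ε) + (stiffness (a + b) - ε) ∧ 0 < stiffness a - ε ∧
        0 < stiffness b - ε ∧
        0 < m 0 * ((stiffness (b - a) - ε) + (stiffness (a + b) - ε)) +
          (m 2 * (stiffness a - ε) + 2 * m 1 * (stiffness (2 * a) - ε)) ∧
        0 < hessianDet (m 0) (m 1) (m 2) (stiffness (b - a) - ε) (stiffness (a + b) - ε)
          (stiffness a - ε) (stiffness b - ε) (stiffness (2 * a) - ε) (stiffness (2 * b) - ε) := by
      have key : ∀ f : ℝ → ℝ, Continuous f → 0 < f 0 → ∀ᶠ ε : ℝ in 𝓝 0, 0 < f ε :=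
        fun f hf h => hf.continuousAt.eventually (lt_mem_nhds h)
      refine (key _ (by fun_prop) (by simpa using c1)).and ((key _ (by fun_prop)
        (by simpa using c2)).and ((key _ (by fun_prop) (by simpa using c3)).and
        ((key _ (by fun_prop) (by simpa using c4)).and (key _ ?_ (by simpa using c5)))))
      unfold hessianDet
      fun_prop
    obtain ⟨ε, ⟨k1, k2, k3, k4, k5⟩, hε⟩ :=
      ((hev.filter_mono nhdsWithin_le_nhds).and (self_mem_nhdsWithin (s := Set.Ioi (0 : ℝ)))).exists
    refine isLocalMin_potential hm hθ.sin_half_sub_pos hcc.sum_force_mul_eq_zero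
      (Set.mem_Ioi.1 hε) fun v => ?_
    rw [hform]
    exact symmetricForm_nonneg hp hq hs k1 k2 k3 k4 k5 v
  · intro v hv
    rw [iteratedDeriv_two_potential m θ v hθ.sin_half_sub_pos]
    have := hform 0 v
    simp only [sub_zero] at this
    rw [hessianForm, this]
    exact symmetricForm_pos hp hq hs c1 c2 c3 c4 c5 hv

theorem exists_rotation_of_isConvexSymmetric {m θ θ' : Fin 5 → ℝ} (hm : ∀ i, 0 < m i)
    (hθ : IsConvexSymmetric θ) (hcc : IsCentralConfiguration m θ)
    (hθ' : IsConvexSymmetric θ') (hcc' : IsCentralConfiguration m θ') :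
    ∃ c : ℝ, ∀ i, θ' i = θ i + c := by
  obtain ⟨a, b, ha, hab, hb, h0, h1, h3, h4⟩ := hθ.exists_angles
  obtain ⟨a', b', ha', hab', hb', h0', h1', h3', h4'⟩ := hθ'.exists_angles
  have hp : 0 < (m 0 + m 4) / 2 := by have := hm 0; have := hm 4; positivity
  have hq : 0 < (m 1 + m 3) / 2 := by have := hm 1; have := hm 3; positivity
  obtain ⟨ea, eb⟩ := reducedEquilibrium_unique hp hq (hm 2) ha hab hb
    (hcc.reducedEquilibrium h0 h1 h3 h4) ha' hab' hb' (hcc'.reducedEquilibrium h0' h1' h3' h4')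
  refine ⟨θ' 2 - θ 2, fun i => ?_⟩
  fin_cases i <;> simp only [Fin.zero_eta, Fin.mk_one, Fin.reduceFinMk] <;> linarith

end Coorbital

theorem theorem5 (m : Fin 5 → ℝ) (hm : ∀ i, 0 < m i) :
    (∀ θ θ' : Fin 5 → ℝ,
      Coorbital.IsConvexSymmetric θ → Coorbital.IsCentralConfiguration m θ →
      Coorbital.IsConvexSymmetric θ' → Coorbital.IsCentralConfiguration m θ' →
      ∃ c : ℝ, ∀ i, θ' i = θ i + c) ∧
    (m 0 = m 4 → m 1 = m 3 → ∀ θ : Fin 5 → ℝ,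
      Coorbital.IsConvexSymmetric θ → Coorbital.IsCentralConfiguration m θ →
      Coorbital.IsNondegenerateMin m θ) :=
  ⟨fun _ _ h1 h2 h3 h4 => Coorbital.exists_rotation_of_isConvexSymmetric hm h1 h2 h3 h4,
    fun m4 m3 _ h1 h2 => Coorbital.isNondegenerateMin_of_isConvexSymmetric hm m4 m3 h1 h2⟩
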